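/- Fix a real number $p>1$. **Setting.** Let $(X,d,m)$ be a metric measure space: $(X,d)$ is a locally compact separable metric space and $m$ is a positive Radon measure on $X$ with full support. Write $B(x,r)=\{y:d(x,y)<r\}$, $V(x,r)=m(B(x,r))$, $\mathrm{diam}(X)=\sup_{x,y}d(x,y)\in[0,\infty]$, and $f_B=\frac1{m(B)}\int_B f\,dm$. For $f\in L^p(X;m)$, $\mathrm{supp}(f)$ is the support of the measure $|f|\,dm$. A *$p$-energy* $(\mathcal E,\mathcal F)$ consists of a dense linear subspace $\mathcal F$ of $L^p(X;m)$ and $\mathcal E:\mathcal F\to[0,\infty)$ such that: (1) $\mathcal E^{1/p}$ is a seminorm; (2) $\mathcal F$ is complete for the norm $\mathcal E^{1/p}+\|\cdot\|_{L^p}$; (3) if $\varphi:\mathbb R\to\mathbb R$ is $1$-Lipschitz with $\varphi(0)=0$ and $f\in\mathcal F$, then $\varphi(f)\in\mathcal F$ and $\mathcal E(\varphi(f))\le\mathcal E(f)$; (4) $\mathcal F\cap C_c(X)$ is uniformly dense in $C_c(X)$ and dense in $\mathcal F$ for the norm in (2); (5) if $f,g\in\mathcal F$ have compact support and $g$ is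 constant in an open neighbourhood of $\mathrm{supp}(f)$, then $\mathcal E(f+g)=\mathcal E(f)+\mathcal E(g)$; (6) for all $f,g\in\mathcal F$, $\mathcal E(f+g)+\mathcal E(f-g)$ is $\ge$ (if $p\le2$), respectively $\le$ (if $p\ge 2$), $2\big(\mathcal E(f)^{1/(p-1)}+\mathcal E(g)^{1/(p-1)}\big)^{p-1}$. A *$p$-energy measure* of $(\mathcal E,\mathcal F)$ assigns to each $f\in\mathcal F$ a positive Radon measure $\Gamma(f)$ on $X$ with $\Gamma(f)(X)=\mathcal E(f)$ such that: for every Borel set $A$, $\Gamma(\cdot)(A)^{1/p}$ is a seminorm on $\mathcal F$ and $\Gamma(\cdot)(A)$ satisfies (6) in place of $\mathcal E$; if $f,g\in\mathcal F\cap C_c(X)$ and $f-g$ is constant on the Borel set $A$, then $\Gamma(f)(A)=\Gamma(g)(A)$; and $d\Gamma(\varphi(f))=|\varphi'(f)|^p\,d\Gamma(f)$ for all $f\in\mathcal F\cap C_c(X)$ and all piecewise $C^1$ functions $\varphi:\mathbb R\to\mathbb R$ with $\varphi(f)\in\mathcal F$. A function $\Phi:[0,\infty)\to[0,\infty)$ is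 *doubling* if it is a homeomorphism and there is $C>1$ with $\Phi(2r)\le C\Phi(r)$ for all $r>0$. Throughout, $\Phi,\Psi$ are doubling, and there are $C>0$ and $0<\beta^{(1)}\le\beta^{(2)}$ with $\frac1C(R/r)^{\beta^{(1)}}\le\Psi(R)/\Psi(r)\le C(R/r)^{\beta^{(2)}}$ for all $0<r\le R$. **Conditions** (the constants are independent of all the points, radii and functions). - CC: there is $C>0$ such that for all $x,y\in X$ and integers $n\ge1$ there are $x=x_0,\dots,x_n=y$ in $X$ with $d(x_k,x_{k-1})\le C\,d(x,y)/n$ for $k=1,\dots,n$. - VD: there is $C>0$ with $V(x,2r)\le CV(x,r)$ for all $x\in X$, $r>0$. - V($\Phi$): there is $C>0$ with $\frac1C\Phi(r)\le V(x,r)\le C\Phi(r)$ for all $x\in X$, $r\in(0,\mathrm{diam}(X))$. - PI($\Psi$): there are $C>0$, $A\ge1$ with $\int_{B(x,r)}|f-f_{B(x,r)}|^p\,dm\le C\Psi(r)\,\Gamma(f)(B(x,Ar))$ for all $x\in X$, $r\in(0,\mathrm{diam}(X)/A)$, $f\in\mathcal F$. - cap($\Psi$)$_\le$: there are $C>0$,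 $A>1$ with $\mathrm{cap}(B(x,r),X\setminus B(x,Ar))\le C\,V(x,r)/\Psi(r)$ for all $x\in X$, $r>0$; cap($\Psi$)$_\ge$: there are $C>0$, $A>1$ with $\mathrm{cap}(B(x,r),X\setminus B(x,Ar))\ge\frac1C\,V(x,r)/\Psi(r)$ for all $x\in X$, $r>0$. Here $\mathrm{cap}(A_1,A_2)\in[0,\infty]$ is the infimum of $\mathcal E(\varphi)$ over the $\varphi\in\mathcal F$ with $\varphi=1$ in an open neighbourhood of $A_1$ and $\varphi=0$ in an open neighbourhood of $A_2$ ($\inf\emptyset=\infty$). **Proposition 2.1.** Let $(X,d,m)$ be a metric measure space and $(\mathcal E,\mathcal F)$ a $p$-energy on it with a $p$-energy measure $\Gamma$, and assume CC. 1. If V($\Phi$), PI($\Psi$) and cap($\Psi$)$_\le$ hold, then there is $C>0$ such that for all $r,R\in(0,\mathrm{diam}(X))$ with $r\le R$, $$\frac1C\Big(\frac Rr\Big)^p\le\frac{\Psi(R)}{\Psi(r)}\le C\Big(\frac Rr\Big)^{p-1}\frac{\Phi(R)}{\Phi(r)}.$$ 2. If $X$ has at least two points, $d_h,\beta_p>0$,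 and V($\Phi$), PI($\Psi$) and cap($\Psi$)$_\le$ hold with $\Phi(r)=r^{d_h}$ and $\Psi(r)=r^{\beta_p}$, then $p\le\beta_p\le d_h+(p-1)$. 3. If VD, PI($\Psi$) and cap($\Psi$)$_\le$ hold, then the lower bound holds: there is $C>0$ such that $\frac1C(R/r)^p\le\Psi(R)/\Psi(r)$ for all $r,R\in(0,\mathrm{diam}(X))$ with $r\le R$. 4. If VD, cap($\Psi$)$_\le$ and cap($\Psi$)$_\ge$ hold, then the same lower bound holds. -/

import Mathlib

open MeasureTheory Filter Topology Set
open scoped NNReal ENNReal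

/-- A doubling function: a homeomorphism `Φ` of `[0, ∞)` onto itself such that
`Φ (2 r) ≤ C Φ r` for all `r > 0`, for some constant `C > 1`. -/
def IsDoubling (Φ : ℝ≥0 → ℝ≥0) : Prop :=
  IsHomeomorph Φ ∧ ∃ C : ℝ≥0, 1 < C ∧ ∀ r : ℝ≥0, 0 < r → Φ (2 * r) ≤ C * Φ r

/-- Two-sided power growth of `Ψ` with positive exponents:
`C⁻¹ (R / r) ^ β₁ ≤ Ψ R / Ψ r ≤ C (R / r) ^ β₂` for all `0 < r ≤ R`. -/
def HasPowerGrowth (Ψ : ℝ≥0 → ℝ≥0) : Prop :=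
  ∃ C β₁ β₂ : ℝ, 0 < C ∧ 0 < β₁ ∧ β₁ ≤ β₂ ∧ ∀ r R : ℝ≥0, 0 < r → r ≤ R →
    C⁻¹ * ((R : ℝ) / r) ^ β₁ ≤ (Ψ R : ℝ) / Ψ r ∧ (Ψ R : ℝ) / Ψ r ≤ C * ((R : ℝ) / r) ^ β₂

/-- The chain condition. -/
def ChainCondition (X : Type*) [MetricSpace X] : Prop :=
  ∃ C : ℝ, 0 < C ∧ ∀ (x y : X) (n : ℕ), 0 < n → ∃ s : ℕ → X, s 0 = x ∧ s n = y ∧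
    ∀ k < n, dist (s (k + 1)) (s k) ≤ C * (dist x y / n)

/-- The diameter of `X`, as an element of `[0, ∞]`. -/
noncomputable def diamSpace (X : Type*) [MetricSpace X] : ℝ≥0∞ :=
  Metric.ediam (univ : Set X)

section Space

variable {X : Type*} [MetricSpace X] [MeasurableSpace X]

/-- The volume doubling condition. -/
def VolumeDoubling (m : Measure X) : Prop :=
  ∃ C : ℝ≥0, 0 < C ∧ ∀ (x : X) (r : ℝ≥0), 0 < r →
    m (Metric.ball x (2 * r)) ≤ C * m (Metric.ball x r)

/-- The volume regular condition with scaling function `Φ`. -/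
def VolumeRegular (m : Measure X) (Φ : ℝ≥0 → ℝ≥0) : Prop :=
  ∃ C : ℝ≥0, 0 < C ∧ ∀ (x : X) (r : ℝ≥0), 0 < r → (r : ℝ≥0∞) < diamSpace X →
    (Φ r : ℝ≥0∞) / C ≤ m (Metric.ball x r) ∧ m (Metric.ball x r) ≤ C * Φ r

/-- The space `L^p (X; m)` of real functions modulo equality almost everywhere. -/
abbrev LpR (p : ℝ) (m : Measure X) : Type _ := Lp ℝ (ENNReal.ofReal p) m

/-- `h` is a continuous compactly supported representative of the class `f`. -/
def IsCcRep {p : ℝ} {m : Measure X} (f : LpR p m) (h : X → ℝ) : Prop :=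
  Continuous h ∧ HasCompactSupport h ∧ f =ᵐ[m] h

/-- The support of `f ∈ L^p`: the support of the measure `|f| dm`. -/
noncomputable def lpSupport {p : ℝ} {m : Measure X} (f : LpR p m) : Set X :=
  (m.withDensity fun x => ‖f x‖ₑ).support

/-- A `p`-energy on `(X, d, m)` (for `p > 1`). -/
structure PEnergy (p : ℝ) (m : Measure X) where
  /-- The domain, a linear subspace of `L^p (X; m)`. -/
  dom : Submodule ℝ (LpR p m)
  /-- The energy functional. -/
  energy : dom → ℝ≥0
  /-- The domain is dense in `L^p`. -/
  dense_dom : ∀ (f : LpR p m) (ε : ℝ), 0 < ε → ∃ g : dom, ‖f - (g : LpR p m)‖ < ε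
  /-- `energy ^ (1 / p)` is absolutely homogeneous. -/
  energy_smul : ∀ (c : ℝ) (f : dom), energy (c • f) ^ (1 / p) = ‖c‖₊ * energy f ^ (1 / p)
  /-- `energy ^ (1 / p)` is subadditive. -/
  energy_add : ∀ f g : dom, energy (f + g) ^ (1 / p) ≤ energy f ^ (1 / p) + energy g ^ (1 / p)
  /-- Closed property: the domain is complete for the norm `energy ^ (1 / p) + ‖·‖`. -/
  complete : ∀ u : ℕ → dom,
    (∀ ε : ℝ, 0 < ε → ∃ N : ℕ, ∀ i ≥ N, ∀ j ≥ N,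
      (energy (u i - u j) : ℝ) ^ (1 / p) + ‖((u i - u j : dom) : LpR p m)‖ < ε) →
    ∃ v : dom, Tendsto
      (fun i => (energy (u i - v) : ℝ) ^ (1 / p) + ‖((u i - v : dom) : LpR p m)‖) atTop (𝓝 0)
  /-- Markovian property. -/
  markov : ∀ (φ : ℝ → ℝ) (hφ : LipschitzWith 1 φ) (h0 : φ 0 = 0) (f : dom),
    ∃ h : hφ.compLp h0 (f : LpR p m) ∈ dom, energy ⟨hφ.compLp h0 (f : LpR p m), h⟩ ≤ energy f
  /-- Regular property, first part: uniform density in `C_c (X)`. -/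
  regular_unif : ∀ g : X → ℝ, Continuous g → HasCompactSupport g → ∀ ε : ℝ, 0 < ε →
    ∃ (f : dom) (h : X → ℝ), IsCcRep (f : LpR p m) h ∧ ∀ x, |g x - h x| < ε
  /-- Regular property, second part: density in the domain. -/
  regular_dense : ∀ (f : dom) (ε : ℝ), 0 < ε →
    ∃ (g : dom) (h : X → ℝ), IsCcRep (g : LpR p m) h ∧
      (energy (f - g) : ℝ) ^ (1 / p) + ‖((f - g : dom) : LpR p m)‖ < ε
  /-- Strongly local property. -/
  strongly_local : ∀ f g : dom,
    IsCompact (lpSupport (f : LpR p m)) → IsCompact (lpSupport (g : LpR p m)) →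
    (∃ (U : Set X) (c : ℝ), IsOpen U ∧ lpSupport (f : LpR p m) ⊆ U ∧
      ∀ᵐ x ∂m, x ∈ U → (g : LpR p m) x = c) →
    energy (f + g) = energy f + energy g
  /-- `p`-Clarkson's inequality for `p ≤ 2`. -/
  clarkson_le : p ≤ 2 → ∀ f g : dom,
    2 * (energy f ^ (1 / (p - 1)) + energy g ^ (1 / (p - 1))) ^ (p - 1) ≤
      energy (f + g) + energy (f - g)
  /-- `p`-Clarkson's inequality for `p ≥ 2`. -/
  clarkson_ge : 2 ≤ p → ∀ f g : dom,
    energy (f + g) + energy (f - g) ≤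
      2 * (energy f ^ (1 / (p - 1)) + energy g ^ (1 / (p - 1))) ^ (p - 1)

/-- A continuous function `φ : ℝ → ℝ` is piecewise `C^1`: off a finite set it is differentiable
with continuous derivative, and at the points of that set the derivative has finite
one-sided limits. -/
def PiecewiseC1 (φ : ℝ → ℝ) : Prop :=
  Continuous φ ∧ ∃ S : Finset ℝ,
    (∀ t ∉ S, DifferentiableAt ℝ φ t ∧ ContinuousAt (deriv φ) t) ∧
    ∀ t ∈ S, (∃ l : ℝ, Tendsto (deriv φ) (𝓝[<] t) (𝓝 l)) ∧
      ∃ l : ℝ, Tendsto (deriv φ) (𝓝[>] t) (𝓝 l)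

/-- A `p`-energy measure of a `p`-energy. -/
structure PEnergy.EnergyMeasure {p : ℝ} {m : Measure X} (𝓔 : PEnergy p m) where
  /-- The Borel measure `Γ(f)` attached to `f`; it is finite by the next field, hence Radon on a
  locally compact separable metric space. -/
  Γ : 𝓔.dom → Measure X
  /-- The total mass of `Γ(f)` is the energy of `f`. -/
  total : ∀ f, Γ f univ = 𝓔.energy f
  /-- `Γ(·)(A) ^ (1 / p)` is absolutely homogeneous. -/
  smul : ∀ A : Set X, MeasurableSet A → ∀ (c : ℝ) (f : 𝓔.dom),
    Γ (c • f) A ^ (1 / p) = ‖c‖ₑ * Γ f A ^ (1 / p)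
  /-- `Γ(·)(A) ^ (1 / p)` is subadditive. -/
  add : ∀ A : Set X, MeasurableSet A → ∀ f g : 𝓔.dom,
    Γ (f + g) A ^ (1 / p) ≤ Γ f A ^ (1 / p) + Γ g A ^ (1 / p)
  /-- Locality on `dom ∩ C_c (X)`. -/
  locality : ∀ (f g : 𝓔.dom) (h k : X → ℝ),
    IsCcRep (f : LpR p m) h → IsCcRep (g : LpR p m) k →
    ∀ A : Set X, MeasurableSet A → (∃ c : ℝ, ∀ x ∈ A, h x - k x = c) → Γ f A = Γ g A
  /-- `p`-Clarkson's inequality for `p ≤ 2`. -/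
  clarkson_le : p ≤ 2 → ∀ (f g : 𝓔.dom) (A : Set X), MeasurableSet A →
    2 * (Γ f A ^ (1 / (p - 1)) + Γ g A ^ (1 / (p - 1))) ^ (p - 1) ≤ Γ (f + g) A + Γ (f - g) A
  /-- `p`-Clarkson's inequality for `p ≥ 2`. -/
  clarkson_ge : 2 ≤ p → ∀ (f g : 𝓔.dom) (A : Set X), MeasurableSet A →
    Γ (f + g) A + Γ (f - g) A ≤ 2 * (Γ f A ^ (1 / (p - 1)) + Γ g A ^ (1 / (p - 1))) ^ (p - 1)
  /-- Chain rule: `dΓ(φ(f)) = |φ'(f)| ^ p dΓ(f)` for `f ∈ dom ∩ C_c (X)` and piecewise `C^1`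
  functions `φ` with `φ(f) ∈ dom` (automatic if `φ 0 = 0`). The value of `φ'` at the finitely
  many break points is immaterial, because `Γ(f)` does not charge the level sets of `f`
  by locality. -/
  chain : ∀ (f g : 𝓔.dom) (h : X → ℝ) (φ : ℝ → ℝ), IsCcRep (f : LpR p m) h → PiecewiseC1 φ →
    (g : LpR p m) =ᵐ[m] (fun x => φ (h x)) →
    Γ g = (Γ f).withDensity fun x => ‖deriv φ (h x)‖ₑ ^ p

/-- The Poincaré inequality with scaling function `Ψ`. -/
def PEnergy.EnergyMeasure.Poincare {p : ℝ} {m : Measure X} {𝓔 : PEnergy p m}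
    (Γ : 𝓔.EnergyMeasure) (Ψ : ℝ≥0 → ℝ≥0) : Prop :=
  ∃ C A : ℝ≥0, 0 < C ∧ 1 ≤ A ∧ ∀ (x : X) (r : ℝ≥0), 0 < r → (r : ℝ≥0∞) < diamSpace X / A →
    ∀ f : 𝓔.dom,
      ∫⁻ y in Metric.ball x r,
          ‖(f : LpR p m) y - ⨍ z in Metric.ball x r, (f : LpR p m) z ∂m‖ₑ ^ p ∂m
        ≤ C * Ψ r * Γ.Γ f (Metric.ball x (A * r))

/-- The capacity between two sets, with values in `[0, ∞]` (it is `∞` if there is no admissible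
function). -/
noncomputable def PEnergy.cap {p : ℝ} {m : Measure X} (𝓔 : PEnergy p m) (A₁ A₂ : Set X) :
    ℝ≥0∞ :=
  ⨅ (φ : 𝓔.dom)
    (_ : (∃ U : Set X, IsOpen U ∧ A₁ ⊆ U ∧ ∀ᵐ x ∂m, x ∈ U → (φ : LpR p m) x = 1) ∧
      ∃ U : Set X, IsOpen U ∧ A₂ ⊆ U ∧ ∀ᵐ x ∂m, x ∈ U → (φ : LpR p m) x = 0),
    (𝓔.energy φ : ℝ≥0∞)

/-- The capacity upper bound with scaling function `Ψ`. -/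
def PEnergy.CapUpper {p : ℝ} {m : Measure X} (𝓔 : PEnergy p m) (Ψ : ℝ≥0 → ℝ≥0) : Prop :=
  ∃ C A : ℝ≥0, 0 < C ∧ 1 < A ∧ ∀ (x : X) (r : ℝ≥0), 0 < r →
    𝓔.cap (Metric.ball x r) (Metric.ball x (A * r))ᶜ ≤ C * (m (Metric.ball x r) / Ψ r)

/-- The capacity lower bound with scaling function `Ψ`. -/
def PEnergy.CapLower {p : ℝ} {m : Measure X} (𝓔 : PEnergy p m) (Ψ : ℝ≥0 → ℝ≥0) : Prop :=
  ∃ C A : ℝ≥0, 0 < C ∧ 1 < A ∧ ∀ (x : X) (r : ℝ≥0), 0 < r →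
    (C : ℝ≥0∞)⁻¹ * (m (Metric.ball x r) / Ψ r) ≤
      𝓔.cap (Metric.ball x r) (Metric.ball x (A * r))ᶜ

end Space

/-! Lower bound. Put N ≈ R/r disjoint shells of width a multiple of r around x, take an r-net of the
ball, and for every net point z a cutoff ψ_z at scale r with energy ≲ V(z,r)/Ψ(r). Let η_k be the
maximum of the ψ_z over the net points lying, up to 2r, inside the inner edge of the k-th shell; it
falls from 1 to 0 within that shell. On the k-th shell the energy measure of Σ η_j is at most that
of η_k, hence at most the sum of the Γ(ψ_z). The shells being disjoint, each ψ_z is charged only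
once, so f = N⁻¹ Σ η_k has energy ≲ N^(-p) V(x,R)/Ψ(r) (`PEnergy.exists_ramp`). Both the Poincaré
inequality and the capacity lower bound force the energy of f to be ≳ V(x,R)/Ψ(R); comparing gives
(R/r)^p Ψ(r) ≲ Ψ(R).

Upper bound. Take a cutoff f at scale R with energy ≲ Φ(R)/Ψ(R) and join a point where f = 1 to one
where f = 0 by a chain of at most a multiple of R/r balls of radius comparable to r with bounded
overlap. The Poincaré inequality bounds the p-th power of each change of approximating constant by
Ψ(r)/Φ(r) times local energy. Telescoping and Hölder give 1 ≲ (R/r)^(p-1) (Ψ(r)/Φ(r)) (Φ(R)/Ψ(R)).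

The analytic difficulty is that locality of Γ is assumed only for continuous compactly supported
functions, whereas capacity yields mere L^p classes. The bridge is lower semicontinuity of Γ(·)(A)
along L^p-convergent sequences of bounded energy (`PEnergy.EnergyMeasure.le_of_tendsto`), a
consequence of Clarkson's inequality. It gives Γ(max(f,g)) ≤ Γ(f) + Γ(g) and the vanishing of Γ(f)
on open sets where f is almost everywhere 0 or almost everywhere 1. -/

/-! ### Uniform convexity of the energy and semicontinuity of the energy measure. -/

section Seminorm

variable {X : Type*} [MetricSpace X] [MeasurableSpace X] {p : ℝ} {m : Measure X}

/-- The seminorm `energy ^ (1 / p)`. -/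
noncomputable def PEnergy.semi (𝓔 : PEnergy p m) (f : 𝓔.dom) : ℝ := (𝓔.energy f : ℝ) ^ (1 / p)

variable {𝓔 : PEnergy p m}

theorem PEnergy.semi_nonneg (f : 𝓔.dom) : 0 ≤ 𝓔.semi f := by
  unfold PEnergy.semi; positivity

theorem PEnergy.semi_smul (c : ℝ) (f : 𝓔.dom) : 𝓔.semi (c • f) = |c| * 𝓔.semi f := by
  have := congrArg (fun t : ℝ≥0 => (t : ℝ)) (𝓔.energy_smul c f)
  simpa [PEnergy.semi] using this

theorem PEnergy.semi_add (f g : 𝓔.dom) : 𝓔.semi (f + g) ≤ 𝓔.semi f + 𝓔.semi g := by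
  have := 𝓔.energy_add f g
  unfold PEnergy.semi
  exact_mod_cast this

theorem PEnergy.semi_neg (f : 𝓔.dom) : 𝓔.semi (-f) = 𝓔.semi f := by
  simpa using 𝓔.semi_smul (-1) f

theorem PEnergy.semi_sub (f g : 𝓔.dom) : 𝓔.semi (f - g) ≤ 𝓔.semi f + 𝓔.semi g := by
  rw [sub_eq_add_neg, ← 𝓔.semi_neg g]; exact 𝓔.semi_add _ _

theorem PEnergy.semi_sub_comm (f g : 𝓔.dom) : 𝓔.semi (f - g) = 𝓔.semi (g - f) := by
  rw [← neg_sub, 𝓔.semi_neg]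

theorem PEnergy.energy_eq (hp : 1 < p) (f : 𝓔.dom) : (𝓔.energy f : ℝ) = 𝓔.semi f ^ p := by
  unfold PEnergy.semi
  rw [← Real.rpow_mul (by positivity), one_div, inv_mul_cancel₀ (by linarith), Real.rpow_one]

theorem PEnergy.semi_mono {f g : 𝓔.dom} (hp : 1 < p) (h : 𝓔.energy f ≤ 𝓔.energy g) :
    𝓔.semi f ≤ 𝓔.semi g := by
  unfold PEnergy.semi
  have : 0 < 1 / p := by positivity
  gcongr

theorem PEnergy.energy_smul_real (hp : 1 < p) (c : ℝ) (f : 𝓔.dom) :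
    (𝓔.energy (c • f) : ℝ) = |c| ^ p * 𝓔.energy f := by
  rw [𝓔.energy_eq hp, 𝓔.energy_eq hp, 𝓔.semi_smul,
    Real.mul_rpow (abs_nonneg _) (𝓔.semi_nonneg f)]

theorem PEnergy.half_add_half_sub (u v : 𝓔.dom) :
    (1 / 2 : ℝ) • (u + v) + (1 / 2 : ℝ) • (u - v) = u ∧
      (1 / 2 : ℝ) • (u + v) - (1 / 2 : ℝ) • (u - v) = v := by
  constructor <;> module

/-- Clarkson for the pair u, v: with both energies at most b its right-hand side is at most 2^p b,
and the energy of u + v is 2^p times that of the midpoint. -/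
theorem PEnergy.energy_sub_le_of_two_le (hp : 1 < p) (h2 : 2 ≤ p) {u v : 𝓔.dom} {a b : ℝ}
    (hu : 𝓔.energy u ≤ b) (hv : 𝓔.energy v ≤ b)
    (huv : a ≤ 𝓔.energy ((1 / 2 : ℝ) • (u + v))) :
    (𝓔.energy (u - v) : ℝ) ≤ 2 ^ p * (b - a) := by
  have h := 𝓔.clarkson_ge h2 u v
  have h' : (𝓔.energy (u + v) : ℝ) + 𝓔.energy (u - v) ≤
      2 * ((𝓔.energy u : ℝ) ^ (1 / (p - 1)) + (𝓔.energy v : ℝ) ^ (1 / (p - 1))) ^ (p - 1) := by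
    exact_mod_cast h
  have hb : 0 ≤ b := le_trans (by positivity) hu
  have hq : 0 < 1 / (p - 1) := by apply one_div_pos.2; linarith
  have h1 : 2 * ((𝓔.energy u : ℝ) ^ (1 / (p - 1)) + (𝓔.energy v : ℝ) ^ (1 / (p - 1))) ^ (p - 1)
      ≤ 2 * (b ^ (1 / (p - 1)) + b ^ (1 / (p - 1))) ^ (p - 1) := by
    have : 0 ≤ p - 1 := by linarith
    gcongr
  have h3 : 2 * (b ^ (1 / (p - 1)) + b ^ (1 / (p - 1))) ^ (p - 1) = 2 ^ p * b := by
    rw [← two_mul, Real.mul_rpow (by norm_num) (by positivity), ← Real.rpow_mul hb, one_div,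
      inv_mul_cancel₀ (by linarith), Real.rpow_one, ← mul_assoc]
    congr 1
    nth_rw 1 [← Real.rpow_one 2]
    rw [← Real.rpow_add (by norm_num)]; ring_nf
  rw [𝓔.energy_smul_real hp] at huv
  have h4 : |(1 / 2 : ℝ)| ^ p = (2 ^ p)⁻¹ := by
    rw [abs_of_pos (by norm_num), one_div, Real.inv_rpow (by norm_num)]
  have h5 : 2 ^ p * a ≤ 𝓔.energy (u + v) := by
    rw [h4] at huv
    have : (0 : ℝ) < 2 ^ p := by positivity
    calc (2 : ℝ) ^ p * a ≤ 2 ^ p * ((2 ^ p)⁻¹ * 𝓔.energy (u + v)) := by gcongr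
      _ = _ := by field_simp
  linarith

/-- Clarkson now bounds from below, so it is applied to the half-sum and the half-difference, whose
sum and difference are u and v. -/
theorem PEnergy.energy_sub_le_of_le_two (hp : 1 < p) (h2 : p ≤ 2) {u v : 𝓔.dom} {a b : ℝ}
    (ha : 0 ≤ a) (hu : 𝓔.energy u ≤ b) (hv : 𝓔.energy v ≤ b)
    (huv : a ≤ 𝓔.energy ((1 / 2 : ℝ) • (u + v))) :
    (𝓔.energy (u - v) : ℝ) ≤ 2 ^ p * (b ^ (1 / (p - 1)) - a ^ (1 / (p - 1))) ^ (p - 1) := by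
  have h := 𝓔.clarkson_le h2 ((1 / 2 : ℝ) • (u + v)) ((1 / 2 : ℝ) • (u - v))
  rw [(PEnergy.half_add_half_sub u v).1, (PEnergy.half_add_half_sub u v).2] at h
  have hb : 0 ≤ b := le_trans (by positivity) hu
  have hq : 0 < 1 / (p - 1) := by apply one_div_pos.2; linarith
  set s : ℝ := (𝓔.energy ((1 / 2 : ℝ) • (u + v)) : ℝ) with hs
  set t : ℝ := (𝓔.energy ((1 / 2 : ℝ) • (u - v)) : ℝ) with ht
  have h' : 2 * (s ^ (1 / (p - 1)) + t ^ (1 / (p - 1))) ^ (p - 1) ≤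
      (𝓔.energy u : ℝ) + 𝓔.energy v := by exact_mod_cast h
  have ht0 : 0 ≤ t := by positivity
  have hs0 : 0 ≤ s := by positivity
  have h1 : (s ^ (1 / (p - 1)) + t ^ (1 / (p - 1))) ^ (p - 1) ≤ b := by linarith
  have hpq : (p - 1) * (1 / (p - 1)) = 1 := by
    rw [mul_one_div_cancel]; linarith
  have key : ∀ x : ℝ, 0 ≤ x → (x ^ (p - 1)) ^ (1 / (p - 1)) = x := fun x hx => by
    rw [← Real.rpow_mul hx, hpq, Real.rpow_one]
  have h3 : s ^ (1 / (p - 1)) + t ^ (1 / (p - 1)) ≤ b ^ (1 / (p - 1)) := by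
    rw [← key (s ^ (1 / (p - 1)) + t ^ (1 / (p - 1))) (by positivity)]
    gcongr
  have h4 : a ^ (1 / (p - 1)) ≤ s ^ (1 / (p - 1)) := by gcongr
  have h5 : t ≤ (b ^ (1 / (p - 1)) - a ^ (1 / (p - 1))) ^ (p - 1) := by
    have : t = (t ^ (1 / (p - 1))) ^ (p - 1) := by
      rw [← Real.rpow_mul ht0, mul_comm, hpq, Real.rpow_one]
    rw [this]
    have : 0 ≤ p - 1 := by linarith
    gcongr
    linarith
  have h6 : (𝓔.energy (u - v) : ℝ) = 2 ^ p * t := by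
    rw [ht, 𝓔.energy_smul_real hp, abs_of_pos (by norm_num), one_div,
      Real.inv_rpow (by norm_num)]
    have : (0 : ℝ) < 2 ^ p := by positivity
    field_simp
  rw [h6]
  gcongr

/-- Uniform convexity of the energy, as a consequence of Clarkson's inequality. -/
theorem PEnergy.exists_modulus (𝓔 : PEnergy p m) (hp : 1 < p) {d ε : ℝ} (hd : 0 ≤ d)
    (hε : 0 < ε) :
    ∃ δ : ℝ, 0 < δ ∧ ∀ u v : 𝓔.dom, 𝓔.energy u ≤ d + δ → 𝓔.energy v ≤ d + δ →
      d - δ ≤ 𝓔.energy ((1 / 2 : ℝ) • (u + v)) → (𝓔.energy (u - v) : ℝ) < ε := by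
  have small : ∀ g : ℝ → ℝ, ContinuousAt g 0 → g 0 = 0 → ∃ δ : ℝ, 0 < δ ∧ g δ < ε := by
    intro g hg h0
    have : ∀ᶠ δ in 𝓝[>] (0 : ℝ), g δ < ε :=
      (hg.eventually_lt continuousAt_const (by rw [h0]; exact hε)).filter_mono nhdsWithin_le_nhds
    obtain ⟨δ, h1, h2⟩ := (this.and self_mem_nhdsWithin).exists
    exact ⟨δ, h2, h1⟩
  rcases le_total 2 p with h2 | h2
  · obtain ⟨δ, hδ, h⟩ := small (fun δ => 2 ^ p * ((d + δ) - (d - δ))) (by fun_prop) (by simp)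
    exact ⟨δ, hδ, fun u v hu hv huv =>
      (PEnergy.energy_sub_le_of_two_le hp h2 hu hv huv).trans_lt h⟩
  · have hq : 0 < 1 / (p - 1) := by apply one_div_pos.2; linarith
    obtain ⟨δ, hδ, h⟩ := small
      -- The maximum keeps the base of the power nonnegative, since d may be smaller than δ.
      (fun δ => 2 ^ p * ((d + δ) ^ (1 / (p - 1)) - (max (d - δ) 0) ^ (1 / (p - 1))) ^ (p - 1))
      (by
        have c1 : Continuous fun x : ℝ => x ^ (1 / (p - 1)) := Real.continuous_rpow_const hq.le
        have c2 : Continuous fun x : ℝ => x ^ (p - 1) :=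
          Real.continuous_rpow_const (by linarith)
        refine Continuous.continuousAt ?_
        exact continuous_const.mul (c2.comp ((c1.comp (by fun_prop)).sub (c1.comp (by fun_prop)))))
      (by
        have : max (d - 0) 0 = d := by simpa using hd
        simp only [this, add_zero, sub_self]
        rw [Real.zero_rpow (by linarith), mul_zero])
    exact ⟨δ, hδ, fun u v hu hv huv =>
      (PEnergy.energy_sub_le_of_le_two hp h2 (le_max_right _ _) hu hv
        (max_le huv (by positivity))).trans_lt h⟩

variable (Γ : 𝓔.EnergyMeasure)

theorem PEnergy.EnergyMeasure.le_semi (hp : 1 < p) (f : 𝓔.dom) (A : Set X) :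
    Γ.Γ f A ^ (1 / p) ≤ ENNReal.ofReal (𝓔.semi f) := by
  have h : Γ.Γ f A ≤ 𝓔.energy f := by
    rw [← Γ.total f]; exact measure_mono (subset_univ A)
  have hq : 0 ≤ 1 / p := by positivity
  calc Γ.Γ f A ^ (1 / p) ≤ (𝓔.energy f : ℝ≥0∞) ^ (1 / p) := by gcongr
    _ = _ := by
      unfold PEnergy.semi
      rw [← ENNReal.ofReal_coe_nnreal, ENNReal.ofReal_rpow_of_nonneg (by positivity) hq]

theorem PEnergy.EnergyMeasure.ne_top (f : 𝓔.dom) (A : Set X) : Γ.Γ f A ≠ ∞ := by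
  have h : Γ.Γ f A ≤ 𝓔.energy f := by
    rw [← Γ.total f]; exact measure_mono (subset_univ A)
  exact ne_top_of_le_ne_top ENNReal.coe_ne_top h

theorem PEnergy.EnergyMeasure.rpow_inv_rpow (hp : 1 < p) (a : ℝ≥0∞) : (a ^ (1 / p)) ^ p = a := by
  rw [← ENNReal.rpow_mul, one_div, inv_mul_cancel₀ (by linarith), ENNReal.rpow_one]

theorem PEnergy.EnergyMeasure.zero_apply (hp : 1 < p) {A : Set X} (hA : MeasurableSet A) :
    Γ.Γ 0 A = 0 := by
  have := Γ.smul A hA 0 0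
  have hp0 : ¬ p < 0 := by linarith
  have h : Γ.Γ 0 A = 0 ∧ 0 < p := by simpa [hp0] using this
  exact h.1

theorem PEnergy.EnergyMeasure.smul_apply (hp : 1 < p) {A : Set X} (hA : MeasurableSet A) (c : ℝ)
    (f : 𝓔.dom) : Γ.Γ (c • f) A = ‖c‖ₑ ^ p * Γ.Γ f A := by
  rw [← rpow_inv_rpow hp (Γ.Γ (c • f) A), Γ.smul A hA, ENNReal.mul_rpow_of_nonneg _ _ (by linarith),
    rpow_inv_rpow hp]

/-- Sublevel sets of `Γ(·)(A)` are midpoint convex. -/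
theorem PEnergy.EnergyMeasure.midpoint_le (hp : 1 < p) {A : Set X} (hA : MeasurableSet A)
    {u v : 𝓔.dom} {c : ℝ≥0∞} (hu : Γ.Γ u A ≤ c) (hv : Γ.Γ v A ≤ c) :
    Γ.Γ ((1 / 2 : ℝ) • (u + v)) A ≤ c := by
  have hq : 0 ≤ 1 / p := by positivity
  have h1 : Γ.Γ ((1 / 2 : ℝ) • (u + v)) A ^ (1 / p) ≤ c ^ (1 / p) := by
    rw [Γ.smul A hA]
    calc ‖(1 / 2 : ℝ)‖ₑ * Γ.Γ (u + v) A ^ (1 / p)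
        ≤ ‖(1 / 2 : ℝ)‖ₑ * (c ^ (1 / p) + c ^ (1 / p)) := by
          gcongr
          refine (Γ.add A hA u v).trans ?_
          gcongr
      _ = c ^ (1 / p) := by
          have : ‖(1 / 2 : ℝ)‖ₑ = 2⁻¹ := by
            rw [← ofReal_norm, Real.norm_of_nonneg (by norm_num), one_div,
              ENNReal.ofReal_inv_of_pos (by norm_num)]
            simp
          rw [this, ← two_mul, ← mul_assoc, ENNReal.inv_mul_cancel (by norm_num) (by norm_num),
            one_mul]
  calc _ = (Γ.Γ ((1 / 2 : ℝ) • (u + v)) A ^ (1 / p)) ^ p := (rpow_inv_rpow hp _).symm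
    _ ≤ (c ^ (1 / p)) ^ p := by gcongr
    _ = c := rpow_inv_rpow hp _

/-- The triangle inequality in both directions for Γ(·)(A)^(1/p), which is dominated by the energy
seminorm. -/
theorem PEnergy.EnergyMeasure.tendsto (hp : 1 < p) {u : ℕ → 𝓔.dom} {f : 𝓔.dom}
    (hu : Tendsto (fun n => 𝓔.semi (u n - f)) atTop (𝓝 0)) {A : Set X} (hA : MeasurableSet A) :
    Tendsto (fun n => Γ.Γ (u n) A) atTop (𝓝 (Γ.Γ f A)) := by
  have hq : 0 ≤ 1 / p := by positivity
  have ho : Tendsto (fun n => ENNReal.ofReal (𝓔.semi (u n - f))) atTop (𝓝 0) := by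
    simpa using ENNReal.tendsto_ofReal hu
  have hf : Γ.Γ f A ^ (1 / p) ≠ ∞ := ENNReal.rpow_ne_top_of_nonneg hq (Γ.ne_top f A)
  have h1 : Tendsto (fun n => Γ.Γ (u n) A ^ (1 / p)) atTop (𝓝 (Γ.Γ f A ^ (1 / p))) := by
    refine tendsto_of_tendsto_of_tendsto_of_le_of_le
      (g := fun n => Γ.Γ f A ^ (1 / p) - ENNReal.ofReal (𝓔.semi (u n - f)))
      (h := fun n => Γ.Γ f A ^ (1 / p) + ENNReal.ofReal (𝓔.semi (u n - f))) ?_ ?_ ?_ ?_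
    · simpa using ENNReal.Tendsto.sub tendsto_const_nhds ho (Or.inl hf)
    · simpa using tendsto_const_nhds.add ho
    · intro n
      rw [tsub_le_iff_right]
      have := Γ.add A hA (u n) (f - u n)
      rw [add_sub_cancel] at this
      refine this.trans ?_
      gcongr
      rw [𝓔.semi_sub_comm]
      exact Γ.le_semi hp _ _
    · intro n
      have := Γ.add A hA f (u n - f)
      rw [add_sub_cancel] at this
      refine this.trans ?_
      beta_reduce
      gcongr
      exact Γ.le_semi hp _ _
  have h2 := h1.ennrpow_const p
  simpa only [rpow_inv_rpow hp] using h2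

/-- Lower semicontinuity of the energy measure along `L^p`-convergent sequences of bounded
energy. -/
theorem PEnergy.EnergyMeasure.le_of_tendsto (hp : 1 < p) {u : ℕ → 𝓔.dom} {f : 𝓔.dom} {b : ℝ}
    (hb : ∀ n, 𝓔.semi (u n) ≤ b)
    (hu : Tendsto (fun n => ‖((u n - f : 𝓔.dom) : LpR p m)‖) atTop (𝓝 0))
    {A : Set X} (hA : MeasurableSet A) {c : ℝ≥0∞} (hc : ∀ᶠ n in atTop, Γ.Γ (u n) A ≤ c) :
    Γ.Γ f A ≤ c := by
  have : Fact (1 ≤ ENNReal.ofReal p) := ⟨by simpa using hp.le⟩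
  -- In place of weak compactness: these sets are decreasing, midpoint convex and shrink to f in
  -- L^p. Near-minimisers of the energy over them are shown to converge in the domain norm.
  let D : ℕ → Set 𝓔.dom := fun n =>
    {v | ‖((v - f : 𝓔.dom) : LpR p m)‖ ≤ 1 / ((n : ℝ) + 1) ∧ Γ.Γ v A ≤ c}
  have Dmono : ∀ {i j : ℕ}, i ≤ j → D j ⊆ D i := by
    intro i j hij v hv
    refine ⟨hv.1.trans ?_, hv.2⟩
    gcongr
  have Dmid : ∀ n, ∀ v ∈ D n, ∀ w ∈ D n, (1 / 2 : ℝ) • (v + w) ∈ D n := by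
    intro n v hv w hw
    refine ⟨?_, Γ.midpoint_le hp hA hv.2 hw.2⟩
    have e : (1 / 2 : ℝ) • (v + w) - f = (1 / 2 : ℝ) • ((v - f) + (w - f)) := by module
    rw [e]
    calc ‖(((1 / 2 : ℝ) • ((v - f) + (w - f)) : 𝓔.dom) : LpR p m)‖
        = 1 / 2 * ‖((v - f : 𝓔.dom) : LpR p m) + ((w - f : 𝓔.dom) : LpR p m)‖ := by
          rw [Submodule.coe_smul, norm_smul, Submodule.coe_add]; norm_num
      _ ≤ 1 / 2 * (‖((v - f : 𝓔.dom) : LpR p m)‖ + ‖((w - f : 𝓔.dom) : LpR p m)‖) := by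
          gcongr; exact norm_add_le _ _
      _ ≤ 1 / 2 * (1 / ((n : ℝ) + 1) + 1 / ((n : ℝ) + 1)) := by
          gcongr
          exacts [hv.1, hw.1]
      _ = _ := by ring
  have hbe : ∀ n, (𝓔.energy (u n) : ℝ) ≤ b ^ p := fun n => by
    rw [𝓔.energy_eq hp]
    have := 𝓔.semi_nonneg (u n)
    have := hb n
    gcongr
  have Dne : ∀ n, ∃ v ∈ D n, (𝓔.energy v : ℝ) ≤ b ^ p := by
    intro n
    have h1 : ∀ᶠ k in atTop, ‖((u k - f : 𝓔.dom) : LpR p m)‖ ≤ 1 / ((n : ℝ) + 1) :=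
      hu.eventually_le_const (by positivity)
    obtain ⟨k, hk1, hk2⟩ := (h1.and hc).exists
    exact ⟨u k, ⟨hk1, hk2⟩, hbe k⟩
  let e : ℕ → ℝ := fun n => sInf ((fun v => (𝓔.energy v : ℝ)) '' D n)
  have ebdd : ∀ n, BddBelow ((fun v => (𝓔.energy v : ℝ)) '' D n) := fun n =>
    ⟨0, by rintro _ ⟨v, -, rfl⟩; positivity⟩
  have ele : ∀ n, ∀ v ∈ D n, e n ≤ 𝓔.energy v := fun n v hv =>
    csInf_le (ebdd n) ⟨v, hv, rfl⟩
  have ene : ∀ n, ((fun v => (𝓔.energy v : ℝ)) '' D n).Nonempty := fun n => by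
    obtain ⟨v, hv, -⟩ := Dne n
    exact ⟨_, v, hv, rfl⟩
  have e0 : ∀ n, 0 ≤ e n := fun n => le_csInf (ene n) (by rintro _ ⟨v, -, rfl⟩; positivity)
  have eB : BddAbove (range e) := ⟨b ^ p, by
    rintro _ ⟨n, rfl⟩
    obtain ⟨v, hv, hvb⟩ := Dne n
    exact (ele n v hv).trans hvb⟩
  -- The infima increase to d. For large i and j the near-minimisers have energy below d + δ while
  -- their midpoint has energy above d - δ, so the modulus of convexity makes them Cauchy.
  set d : ℝ := ⨆ n, e n with hd
  have hed : ∀ n, e n ≤ d := fun n => le_ciSup eB n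
  have hw : ∀ n : ℕ, ∃ v ∈ D n, (𝓔.energy v : ℝ) < d + 1 / ((n : ℝ) + 1) := by
    intro n
    have : e n < d + 1 / ((n : ℝ) + 1) := by
      have : 0 < 1 / ((n : ℝ) + 1) := by positivity
      linarith [hed n]
    obtain ⟨_, ⟨v, hv, rfl⟩, h⟩ := exists_lt_of_csInf_lt (ene n) this
    exact ⟨v, hv, h⟩
  choose w hwD hwE using hw
  have hcau : ∀ ε : ℝ, 0 < ε → ∃ N : ℕ, ∀ i ≥ N, ∀ j ≥ N,
      (𝓔.energy (w i - w j) : ℝ) ^ (1 / p) + ‖((w i - w j : 𝓔.dom) : LpR p m)‖ < ε := by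
    intro ε hε
    obtain ⟨δ, hδ, hmod⟩ := 𝓔.exists_modulus hp ((e0 0).trans (hed 0))
      (Real.rpow_pos_of_pos (half_pos hε) p)
    obtain ⟨N₁, hN₁⟩ : ∃ N, d - δ < e N := exists_lt_of_lt_ciSup (by rw [← hd]; linarith)
    obtain ⟨N₂, hN₂⟩ := exists_nat_one_div_lt (lt_min hδ (show 0 < ε / 4 by positivity))
    refine ⟨max N₁ N₂, fun i hi j hj => ?_⟩
    have hsm : ∀ k ≥ max N₁ N₂, 1 / ((k : ℝ) + 1) < min δ (ε / 4) := fun k hk => by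
      refine lt_of_le_of_lt ?_ hN₂
      have : (N₂ : ℝ) ≤ k := by exact_mod_cast (le_max_right _ _).trans hk
      gcongr
    have hE : (𝓔.energy (w i - w j) : ℝ) < (ε / 2) ^ p := by
      refine hmod _ _ ?_ ?_ ?_
      · exact (hwE i).le.trans (by linarith [(hsm i hi).trans_le (min_le_left _ _)])
      · exact (hwE j).le.trans (by linarith [(hsm j hj).trans_le (min_le_left _ _)])
      · refine hN₁.le.trans (ele _ _ (Dmid _ _ ?_ _ ?_))
        · exact Dmono ((le_max_left _ _).trans hi) (hwD i)
        · exact Dmono ((le_max_left _ _).trans hj) (hwD j)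
    have h1 : (𝓔.energy (w i - w j) : ℝ) ^ (1 / p) < ε / 2 := by
      have hq : 0 < 1 / p := by positivity
      calc _ < ((ε / 2) ^ p) ^ (1 / p) := by gcongr
        _ = ε / 2 := by
          rw [← Real.rpow_mul (by positivity), mul_one_div_cancel (by linarith), Real.rpow_one]
    have h2 : ‖((w i - w j : 𝓔.dom) : LpR p m)‖ < ε / 2 := by
      have e2 : ((w i - w j : 𝓔.dom) : LpR p m) =
          ((w i - f : 𝓔.dom) : LpR p m) - ((w j - f : 𝓔.dom) : LpR p m) := by
        simp
      rw [e2]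
      refine (norm_sub_le _ _).trans_lt ?_
      have a1 := (hwD i).1.trans_lt ((hsm i hi).trans_le (min_le_right _ _))
      have a2 := (hwD j).1.trans_lt ((hsm j hj).trans_le (min_le_right _ _))
      linarith
    linarith
  obtain ⟨v, hv⟩ := 𝓔.complete w hcau
  have hvs : Tendsto (fun i => 𝓔.semi (w i - v)) atTop (𝓝 0) :=
    squeeze_zero (fun i => 𝓔.semi_nonneg _)
      (fun i => le_add_of_nonneg_right (norm_nonneg _)) hv
  have hvn : Tendsto (fun i => ‖((w i - v : 𝓔.dom) : LpR p m)‖) atTop (𝓝 0) :=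
    squeeze_zero (fun i => norm_nonneg _)
      (fun i => le_add_of_nonneg_left (𝓔.semi_nonneg _)) hv
  have hfn : Tendsto (fun i => ‖((w i - f : 𝓔.dom) : LpR p m)‖) atTop (𝓝 0) :=
    squeeze_zero (fun i => norm_nonneg _) (fun i => (hwD i).1)
      tendsto_one_div_add_atTop_nhds_zero_nat
  have hvf : v = f := by
    have t1 : Tendsto (fun i => (w i : LpR p m)) atTop (𝓝 (v : LpR p m)) :=
      tendsto_iff_norm_sub_tendsto_zero.2 (by simpa using hvn)
    have t2 : Tendsto (fun i => (w i : LpR p m)) atTop (𝓝 (f : LpR p m)) :=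
      tendsto_iff_norm_sub_tendsto_zero.2 (by simpa using hfn)
    exact Subtype.ext (tendsto_nhds_unique t1 t2)
  rw [← hvf]
  exact _root_.le_of_tendsto (Γ.tendsto hp hvs hA) (Eventually.of_forall fun n => (hwD n).2)

end Seminorm

/-! ### Maxima, truncations and almost everywhere locality. -/

section Lattice

/-- Writing the maximum through an absolute value lets the Markov property act on maxima. -/
theorem LpR.sup_eq {X : Type*} [MeasurableSpace X] {p : ℝ} {m : Measure X} (f g : LpR p m) :
    f ⊔ g = (1 / 2 : ℝ) • (f + g + lipschitzWith_one_norm.compLp norm_zero (f - g)) := by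
  refine Lp.ext ?_
  filter_upwards [Lp.coeFn_sup f g, Lp.coeFn_add f g, Lp.coeFn_sub f g,
    (lipschitzWith_one_norm (E := ℝ)).coeFn_compLp norm_zero (f - g),
    Lp.coeFn_smul (1 / 2 : ℝ) (f + g + (lipschitzWith_one_norm (E := ℝ)).compLp norm_zero (f - g)),
    Lp.coeFn_add (f + g) ((lipschitzWith_one_norm (E := ℝ)).compLp norm_zero (f - g))]
    with x h1 h2 h3 h4 h5 h6
  rw [h1, h5, Pi.smul_apply, h6, Pi.add_apply, h2, Pi.add_apply, h4, Function.comp_apply, h3,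
    Pi.sub_apply, Pi.sup_apply, Real.norm_eq_abs, smul_eq_mul]
  rcases le_total (f x) (g x) with h | h
  · rw [sup_eq_right.2 h, abs_of_nonpos (by linarith)]; ring
  · rw [sup_eq_left.2 h, abs_of_nonneg (by linarith)]; ring

variable {X : Type*} [MetricSpace X] [MeasurableSpace X] {p : ℝ} {m : Measure X}

/-- Truncation of real numbers to the unit interval. -/
def unitClamp (t : ℝ) : ℝ := max 0 (min t 1)

theorem lipschitzWith_unitClamp : LipschitzWith 1 unitClamp :=
  (LipschitzWith.id.min_const 1).const_max 0

theorem unitClamp_zero : unitClamp 0 = 0 := by simp [unitClamp]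

theorem unitClamp_nonneg (t : ℝ) : 0 ≤ unitClamp t := le_max_left _ _

theorem unitClamp_le_one (t : ℝ) : unitClamp t ≤ 1 := max_le zero_le_one (min_le_right _ _)

theorem unitClamp_of_mem {t : ℝ} (h0 : 0 ≤ t) (h1 : t ≤ 1) : unitClamp t = t := by
  simp [unitClamp, h0, h1]

theorem unitClamp_of_one_le {t : ℝ} (h : 1 ≤ t) : unitClamp t = 1 := by simp [unitClamp, h]

theorem unitClamp_of_nonpos {t : ℝ} (h : t ≤ 0) : unitClamp t = 0 :=
  max_eq_left ((min_le_left _ _).trans h)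

theorem lipschitzWith_unitClamp_sub_one : LipschitzWith 1 fun t : ℝ => unitClamp (t - 1) := by
  have h : LipschitzWith 1 fun t : ℝ => t - 1 := by
    refine LipschitzWith.of_dist_le_mul fun x y => ?_
    simp
  have h' := lipschitzWith_unitClamp.comp h
  rw [one_mul] at h'
  exact h'

theorem unitClamp_zero_sub_one : unitClamp (0 - 1) = 0 := unitClamp_of_nonpos (by norm_num)

theorem IsCcRep.zero : IsCcRep (0 : LpR p m) (fun _ => 0) :=
  ⟨continuous_const, HasCompactSupport.zero, Lp.coeFn_zero _ _ _⟩

theorem IsCcRep.comp {f : LpR p m} {h : X → ℝ} (hf : IsCcRep f h) {φ : ℝ → ℝ}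
    (hφ : LipschitzWith 1 φ) (h0 : φ 0 = 0) : IsCcRep (hφ.compLp h0 f) (fun x => φ (h x)) := by
  refine ⟨hφ.continuous.comp hf.1, hf.2.1.comp_left h0, ?_⟩
  filter_upwards [hφ.coeFn_compLp h0 f, hf.2.2] with x h1 h2
  rw [h1, Function.comp_apply, h2]

theorem IsCcRep.sub {f g : LpR p m} {h k : X → ℝ} (hf : IsCcRep f h) (hg : IsCcRep g k) :
    IsCcRep (f - g) (fun x => h x - k x) := by
  refine ⟨hf.1.sub hg.1, hf.2.1.comp₂_left hg.2.1 (m := fun a b : ℝ => a - b) (by simp), ?_⟩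
  filter_upwards [Lp.coeFn_sub f g, hf.2.2, hg.2.2] with x h1 h2 h3
  rw [h1, Pi.sub_apply, h2, h3]

theorem IsCcRep.sup {f g : LpR p m} {h k : X → ℝ} (hf : IsCcRep f h) (hg : IsCcRep g k) :
    IsCcRep (f ⊔ g) (fun x => max (h x) (k x)) := by
  refine ⟨hf.1.max hg.1, hf.2.1.comp₂_left hg.2.1 (m := fun a b : ℝ => max a b) (by simp), ?_⟩
  filter_upwards [Lp.coeFn_sup f g, hf.2.2, hg.2.2] with x h1 h2 h3
  rw [h1, Pi.sup_apply, h2, h3]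

variable {𝓔 : PEnergy p m}

theorem PEnergy.sup_mem (f g : 𝓔.dom) : (f : LpR p m) ⊔ (g : LpR p m) ∈ 𝓔.dom := by
  rw [LpR.sup_eq]
  obtain ⟨h, -⟩ := 𝓔.markov _ lipschitzWith_one_norm norm_zero (f - g)
  exact 𝓔.dom.smul_mem _ (𝓔.dom.add_mem (𝓔.dom.add_mem f.2 g.2) h)

/-- The pointwise maximum of two elements of the domain. -/
noncomputable def PEnergy.sup (f g : 𝓔.dom) : 𝓔.dom := ⟨(f : LpR p m) ⊔ (g : LpR p m), sup_mem f g⟩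

theorem PEnergy.semi_sup_le (hp : 1 < p) (f g : 𝓔.dom) :
    𝓔.semi (PEnergy.sup f g) ≤ 𝓔.semi f + 𝓔.semi g := by
  obtain ⟨h, he⟩ := 𝓔.markov _ lipschitzWith_one_norm norm_zero (f - g)
  have e : PEnergy.sup f g = (1 / 2 : ℝ) •
      (f + g + ⟨lipschitzWith_one_norm.compLp norm_zero ((f - g : 𝓔.dom) : LpR p m), h⟩) :=
    Subtype.ext (LpR.sup_eq _ _)
  have h1 := (PEnergy.semi_mono hp he).trans (𝓔.semi_sub f g)
  rw [e, 𝓔.semi_smul]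
  have h2 := 𝓔.semi_add (f + g)
    ⟨lipschitzWith_one_norm.compLp norm_zero ((f - g : 𝓔.dom) : LpR p m), h⟩
  have h3 := 𝓔.semi_add f g
  rw [abs_of_pos (by norm_num)]
  linarith

theorem PEnergy.sup_ae (f g : 𝓔.dom) : ∀ᵐ x ∂m,
    (PEnergy.sup f g : LpR p m) x = max ((f : LpR p m) x) ((g : LpR p m) x) :=
  Lp.coeFn_sup _ _

/-- Composition of an element of the domain with a normal contraction. -/
noncomputable def PEnergy.comp {φ : ℝ → ℝ} (hφ : LipschitzWith 1 φ) (h0 : φ 0 = 0) (f : 𝓔.dom) :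
    𝓔.dom := ⟨hφ.compLp h0 (f : LpR p m), (𝓔.markov φ hφ h0 f).1⟩

theorem PEnergy.energy_comp_le {φ : ℝ → ℝ} (hφ : LipschitzWith 1 φ) (h0 : φ 0 = 0) (f : 𝓔.dom) :
    𝓔.energy (PEnergy.comp hφ h0 f) ≤ 𝓔.energy f := (𝓔.markov φ hφ h0 f).2

theorem PEnergy.comp_ae {φ : ℝ → ℝ} (hφ : LipschitzWith 1 φ) (h0 : φ 0 = 0) (f : 𝓔.dom) :
    ∀ᵐ x ∂m, (PEnergy.comp hφ h0 f : LpR p m) x = φ ((f : LpR p m) x) :=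
  hφ.coeFn_compLp h0 _

/-- The truncation of an element of the domain to the unit interval. -/
noncomputable def PEnergy.clamp (f : 𝓔.dom) : 𝓔.dom :=
  PEnergy.comp lipschitzWith_unitClamp unitClamp_zero f

theorem PEnergy.clamp_ae (f : 𝓔.dom) :
    ∀ᵐ x ∂m, (PEnergy.clamp f : LpR p m) x = unitClamp ((f : LpR p m) x) :=
  PEnergy.comp_ae _ _ f

theorem PEnergy.clamp_eq {f : 𝓔.dom}
    (hf : ∀ᵐ x ∂m, 0 ≤ (f : LpR p m) x ∧ (f : LpR p m) x ≤ 1) : PEnergy.clamp f = f := by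
  refine Subtype.ext (Lp.ext ?_)
  filter_upwards [hf, PEnergy.clamp_ae f] with x h1 h2
  rw [h2, unitClamp_of_mem h1.1 h1.2]

theorem PEnergy.exists_bump [LocallyCompactSpace X] {x : X} {U : Set X} (hU : IsOpen U)
    (hx : x ∈ U) : ∃ (V : Set X) (η : 𝓔.dom) (h : X → ℝ), IsOpen V ∧ x ∈ V ∧ V ⊆ U ∧
      IsCcRep (η : LpR p m) h ∧ (∀ y, 0 ≤ h y ∧ h y ≤ 1) ∧ (∀ y ∈ V, h y = 1) ∧
      ∀ y ∉ U, h y = 0 := by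
  obtain ⟨K, hK, hxK, hKU⟩ := exists_compact_subset hU hx
  obtain ⟨g, hg1, hg0, hgc, -⟩ := exists_continuous_one_zero_of_isCompact hK hU.isClosed_compl
    (disjoint_compl_right_iff_subset.2 hKU)
  -- Regularity gives only an approximation with error below 1. Tripling g makes k exceed 2 where g
  -- = 1 and stay below 1 where g = 0, so truncating k - 1 to [0,1] gives exactly 1 and 0.
  obtain ⟨f, k, hk, hkg⟩ := 𝓔.regular_unif (fun y => 3 * g y) (by fun_prop)
    (hgc.comp_left (g := fun t : ℝ => 3 * t) (by simp)) 1 one_pos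
  refine ⟨interior K, PEnergy.comp lipschitzWith_unitClamp_sub_one unitClamp_zero_sub_one f,
    fun y => unitClamp (k y - 1), isOpen_interior, hxK, interior_subset.trans hKU,
    hk.comp lipschitzWith_unitClamp_sub_one unitClamp_zero_sub_one,
    fun y => ⟨unitClamp_nonneg _, unitClamp_le_one _⟩, fun y hy => ?_, fun y hy => ?_⟩
  · have h1 := hkg y
    rw [hg1 (interior_subset hy), abs_lt, Pi.one_apply] at h1
    exact unitClamp_of_one_le (by linarith)
  · have h1 := hkg y
    rw [hg0 hy, abs_lt, Pi.zero_apply] at h1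
    exact unitClamp_of_nonpos (by linarith)

/-- Split A according to which function is larger; on each piece the maximum coincides with that
function and locality applies. -/
theorem PEnergy.EnergyMeasure.sup_le_of_isCcRep [BorelSpace X] (Γ : 𝓔.EnergyMeasure) {f g : 𝓔.dom} {h k : X → ℝ}
    (hf : IsCcRep (f : LpR p m) h) (hg : IsCcRep (g : LpR p m) k) {A : Set X}
    (hA : MeasurableSet A) : Γ.Γ (PEnergy.sup f g) A ≤ Γ.Γ f A + Γ.Γ g A := by
  have hS : MeasurableSet {x | k x ≤ h x} := (isClosed_le hg.1 hf.1).measurableSet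
  rw [← measure_inter_add_sdiff A hS]
  have h1 : Γ.Γ (PEnergy.sup f g) (A ∩ {x | k x ≤ h x}) = Γ.Γ f (A ∩ {x | k x ≤ h x}) :=
    Γ.locality _ _ _ _ (hf.sup hg) hf _ (hA.inter hS) ⟨0, fun x hx => by
      rw [max_eq_left hx.2, sub_self]⟩
  have h2 : Γ.Γ (PEnergy.sup f g) (A \ {x | k x ≤ h x}) = Γ.Γ g (A \ {x | k x ≤ h x}) :=
    Γ.locality _ _ _ _ (hf.sup hg) hg _ (hA.diff hS) ⟨0, fun x hx => by
      rw [max_eq_right (not_le.1 hx.2).le, sub_self]⟩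
  rw [h1, h2]
  gcongr
  · exact inter_subset_left
  · exact sdiff_subset

theorem PEnergy.EnergyMeasure.eq_zero_of_const (Γ : 𝓔.EnergyMeasure) {f : 𝓔.dom} {h : X → ℝ} (hp : 1 < p)
    (hf : IsCcRep (f : LpR p m) h) {A : Set X} (hA : MeasurableSet A) {c : ℝ}
    (hc : ∀ x ∈ A, h x = c) : Γ.Γ f A = 0 := by
  rw [Γ.locality f 0 h _ hf IsCcRep.zero A hA ⟨c, fun x hx => by rw [hc x hx, sub_zero]⟩]
  exact Γ.zero_apply hp hA

section Topology

variable [Fact (1 ≤ ENNReal.ofReal p)]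

theorem PEnergy.exists_approx (f : 𝓔.dom) : ∃ (u : ℕ → 𝓔.dom) (h : ℕ → X → ℝ) (b : ℝ),
    (∀ n, IsCcRep (u n : LpR p m) (h n)) ∧ (∀ n, 𝓔.semi (u n) ≤ b) ∧
    Tendsto (fun n => 𝓔.semi (u n - f)) atTop (𝓝 0) ∧
    Tendsto (fun n => ‖((u n - f : 𝓔.dom) : LpR p m)‖) atTop (𝓝 0) := by
  have h := fun n : ℕ => 𝓔.regular_dense f (1 / ((n : ℝ) + 1)) (by positivity)
  choose u h hu hE using h
  have hs : ∀ n, 𝓔.semi (u n - f) ≤ 1 / ((n : ℝ) + 1) := fun n => by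
    rw [𝓔.semi_sub_comm]
    exact (le_add_of_nonneg_right (norm_nonneg _)).trans (hE n).le
  refine ⟨u, h, 𝓔.semi f + 1, hu, fun n => ?_, ?_, ?_⟩
  · have h1 := 𝓔.semi_add f (u n - f)
    rw [add_sub_cancel] at h1
    have h2 : 1 / ((n : ℝ) + 1) ≤ 1 := by
      rw [div_le_one (by positivity)]
      have : (0 : ℝ) ≤ n := by positivity
      linarith
    linarith [hs n]
  · exact squeeze_zero (fun n => 𝓔.semi_nonneg _) hs tendsto_one_div_add_atTop_nhds_zero_nat
  · refine squeeze_zero (fun n => norm_nonneg _) (fun n => ?_)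
      tendsto_one_div_add_atTop_nhds_zero_nat
    have e : ((u n - f : 𝓔.dom) : LpR p m) = -((f - u n : 𝓔.dom) : LpR p m) := by simp
    rw [e, Lp.norm_neg]
    exact (le_add_of_nonneg_left (𝓔.semi_nonneg (f - u n))).trans (hE n).le

theorem PEnergy.tendsto_coe_iff {u : ℕ → 𝓔.dom} {f : 𝓔.dom} :
    Tendsto (fun n => ‖((u n - f : 𝓔.dom) : LpR p m)‖) atTop (𝓝 0) ↔
      Tendsto (fun n => (u n : LpR p m)) atTop (𝓝 (f : LpR p m)) := by
  rw [tendsto_iff_norm_sub_tendsto_zero (f := fun n => (u n : LpR p m))]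
  rfl

/-- Truncating the approximants keeps their energies bounded and their convergence in L^p.
Convergence in the energy seminorm is no longer claimed, and semicontinuity does not need it. -/
theorem PEnergy.exists_approx_unit (hp : 1 < p) {f : 𝓔.dom}
    (hf : ∀ᵐ x ∂m, 0 ≤ (f : LpR p m) x ∧ (f : LpR p m) x ≤ 1) :
    ∃ (u : ℕ → 𝓔.dom) (h : ℕ → X → ℝ) (b : ℝ),
      (∀ n, IsCcRep (u n : LpR p m) (h n)) ∧ (∀ n x, 0 ≤ h n x ∧ h n x ≤ 1) ∧
      (∀ n, 𝓔.semi (u n) ≤ b) ∧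
      Tendsto (fun n => (u n : LpR p m)) atTop (𝓝 (f : LpR p m)) := by
  obtain ⟨u, h, b, hu, hb, -, ht⟩ := PEnergy.exists_approx f
  refine ⟨fun n => PEnergy.clamp (u n), fun n x => unitClamp (h n x), b,
    fun n => (hu n).comp lipschitzWith_unitClamp unitClamp_zero, fun n x => ⟨unitClamp_nonneg _, unitClamp_le_one _⟩,
    fun n => (PEnergy.semi_mono hp (PEnergy.energy_comp_le lipschitzWith_unitClamp unitClamp_zero (u n))).trans
      (hb n), ?_⟩
  have h1 := (lipschitzWith_unitClamp.continuous_compLp (p := ENNReal.ofReal p) (μ := m)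
    unitClamp_zero).tendsto (f : LpR p m)
  have h2 := h1.comp (PEnergy.tendsto_coe_iff.1 ht)
  have h3 : lipschitzWith_unitClamp.compLp unitClamp_zero (f : LpR p m) = f :=
    congrArg Subtype.val (PEnergy.clamp_eq hf)
  rw [h3] at h2
  exact h2

variable (Γ : 𝓔.EnergyMeasure)

/-- The maximum is continuous in L^p and keeps energies bounded, so the continuous case passes to
the limit by semicontinuity. -/
theorem PEnergy.EnergyMeasure.sup_le [BorelSpace X] (hp : 1 < p) (f g : 𝓔.dom) {A : Set X}
    (hA : MeasurableSet A) : Γ.Γ (PEnergy.sup f g) A ≤ Γ.Γ f A + Γ.Γ g A := by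
  obtain ⟨u, h, b, hu, hb, hs, ht⟩ := PEnergy.exists_approx f
  obtain ⟨v, k, c, hv, hc, hs', ht'⟩ := PEnergy.exists_approx g
  -- Semicontinuity asks for one constant bounding the sequence eventually; any value strictly above
  -- the limit of the sums will do.
  refine le_of_forall_gt fun d hd => ?_
  obtain ⟨e, he, hed⟩ := exists_between hd
  refine lt_of_le_of_lt ?_ hed
  refine Γ.le_of_tendsto hp (u := fun n => PEnergy.sup (u n) (v n)) (b := b + c)
    (fun n => (PEnergy.semi_sup_le hp _ _).trans (add_le_add (hb n) (hc n))) ?_ hA ?_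
  · rw [PEnergy.tendsto_coe_iff] at ht ht' ⊢
    exact ht.sup_nhds ht'
  · have := ((Γ.tendsto hp hs hA).add (Γ.tendsto hp hs' hA)).eventually_le_const he
    filter_upwards [this] with n hn
    exact (Γ.sup_le_of_isCcRep (hu n) (hv n) hA).trans hn

variable [BorelSpace X] [LocallyCompactSpace X] [SecondCountableTopology X]

/-- With a bump η supported in U and equal to 1 on V, the positive part of u_n - η vanishes on V
because u_n ≤ 1. It still converges to f, since f = 0 on U and η = 0 elsewhere. Nullity of such
neighbourhoods V gives nullity of U. -/
theorem PEnergy.EnergyMeasure.eq_zero_of_ae_zero (hp : 1 < p) {f : 𝓔.dom}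
    (hf : ∀ᵐ x ∂m, 0 ≤ (f : LpR p m) x ∧ (f : LpR p m) x ≤ 1) {U : Set X} (hU : IsOpen U)
    (h0 : ∀ᵐ x ∂m, x ∈ U → (f : LpR p m) x = 0) : Γ.Γ f U = 0 := by
  refine measure_null_of_locally_null U fun x hx => ?_
  obtain ⟨V, η, h, hV, hxV, hVU, hη, hη01, hη1, hη0⟩ := PEnergy.exists_bump (𝓔 := 𝓔) hU hx
  refine ⟨V, mem_nhdsWithin_of_mem_nhds (hV.mem_nhds hxV), ?_⟩
  obtain ⟨u, k, b, hu, hk, hb, ht⟩ := PEnergy.exists_approx_unit hp hf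
  rw [← nonpos_iff_eq_zero]
  refine Γ.le_of_tendsto hp (u := fun n => PEnergy.sup (u n - η) 0)
    (b := b + 𝓔.semi η + 𝓔.semi 0) (fun n => ?_) ?_ hV.measurableSet
    (Eventually.of_forall fun n => ?_)
  · have h1 := PEnergy.semi_sup_le hp (u n - η) 0
    have h2 := 𝓔.semi_sub (u n) η
    linarith [hb n]
  · rw [PEnergy.tendsto_coe_iff]
    have h1 : Tendsto (fun n => ((PEnergy.sup (u n - η) 0 : 𝓔.dom) : LpR p m)) atTop
        (𝓝 (((f : LpR p m) - (η : LpR p m)) ⊔ 0)) :=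
      (ht.sub_const (η : LpR p m)).sup_nhds tendsto_const_nhds
    convert h1 using 2
    refine Lp.ext ?_
    filter_upwards [Lp.coeFn_sup ((f : LpR p m) - (η : LpR p m)) 0,
      Lp.coeFn_sub (f : LpR p m) (η : LpR p m), Lp.coeFn_zero ℝ (ENNReal.ofReal p) m, hf, h0,
      hη.2.2] with y a1 a2 a3 a4 a5 a6
    rw [a1, Pi.sup_apply, a2, Pi.sub_apply, a3, Pi.zero_apply, a6]
    by_cases hy : y ∈ U
    · rw [a5 hy, sup_eq_right.2]
      linarith [(hη01 y).1]
    · rw [hη0 y hy, sub_zero, sup_eq_left.2 a4.1]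
  · refine (Γ.eq_zero_of_const hp (((hu n).sub hη).sup IsCcRep.zero) hV.measurableSet (c := 0)
      fun y hy => ?_).le
    rw [hη1 y hy, max_eq_right]
    linarith [(hk n y).2]

/-- The same localisation with max(u_n, η), which is identically 1 on V and converges to f. -/
theorem PEnergy.EnergyMeasure.eq_zero_of_ae_one (hp : 1 < p) {f : 𝓔.dom}
    (hf : ∀ᵐ x ∂m, 0 ≤ (f : LpR p m) x ∧ (f : LpR p m) x ≤ 1) {U : Set X} (hU : IsOpen U)
    (h1 : ∀ᵐ x ∂m, x ∈ U → (f : LpR p m) x = 1) : Γ.Γ f U = 0 := by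
  refine measure_null_of_locally_null U fun x hx => ?_
  obtain ⟨V, η, h, hV, hxV, hVU, hη, hη01, hη1, hη0⟩ := PEnergy.exists_bump (𝓔 := 𝓔) hU hx
  refine ⟨V, mem_nhdsWithin_of_mem_nhds (hV.mem_nhds hxV), ?_⟩
  obtain ⟨u, k, b, hu, hk, hb, ht⟩ := PEnergy.exists_approx_unit hp hf
  rw [← nonpos_iff_eq_zero]
  refine Γ.le_of_tendsto hp (u := fun n => PEnergy.sup (u n) η)
    (b := b + 𝓔.semi η) (fun n => ?_) ?_ hV.measurableSet
    (Eventually.of_forall fun n => ?_)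
  · have h1 := PEnergy.semi_sup_le hp (u n) η
    linarith [hb n]
  · rw [PEnergy.tendsto_coe_iff]
    have h2 : Tendsto (fun n => ((PEnergy.sup (u n) η : 𝓔.dom) : LpR p m)) atTop
        (𝓝 ((f : LpR p m) ⊔ (η : LpR p m))) := ht.sup_nhds tendsto_const_nhds
    convert h2 using 2
    refine Lp.ext ?_
    filter_upwards [Lp.coeFn_sup (f : LpR p m) (η : LpR p m), hf, h1, hη.2.2] with y a1 a4 a5 a6
    rw [a1, Pi.sup_apply, a6]
    by_cases hy : y ∈ U
    · rw [a5 hy, sup_eq_left.2 (hη01 y).2]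
    · rw [hη0 y hy, sup_eq_left.2 a4.1]
  · refine (Γ.eq_zero_of_const hp ((hu n).sup hη) hV.measurableSet (c := 1) fun y hy => ?_).le
    rw [hη1 y hy, max_eq_right (hk n y).2]

end Topology

end Lattice

/-! ### Packing bounds and nets from local doubling. -/

section Doubling

theorem ofReal_lt_diamSpace_of_le {X : Type*} [MetricSpace X] {a b : ℝ} (h : a ≤ b) (hb : ENNReal.ofReal b < diamSpace X) :
    ENNReal.ofReal a < diamSpace X :=
  (ENNReal.ofReal_le_ofReal h).trans_lt hb

variable {X : Type*} [MetricSpace X] [MeasurableSpace X] {m : Measure X} {D : ℝ≥0}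

/-- Volume doubling, with finite volumes, for balls that are smaller than the space. -/
def LocallyDoubling (m : Measure X) (D : ℝ≥0) : Prop :=
  (∀ (x : X) (r : ℝ), 0 < r → ENNReal.ofReal (2 * r) < diamSpace X →
    m (Metric.ball x (2 * r)) ≤ D * m (Metric.ball x r)) ∧
  ∀ (x : X) (r : ℝ), ENNReal.ofReal r < diamSpace X → m (Metric.ball x r) ≠ ∞

theorem LocallyDoubling.iterate (hD : LocallyDoubling m D) (k : ℕ) (x : X) {r : ℝ} (hr : 0 < r)
    (h : ENNReal.ofReal (2 ^ k * r) < diamSpace X) :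
    m (Metric.ball x (2 ^ k * r)) ≤ (D : ℝ≥0∞) ^ k * m (Metric.ball x r) := by
  induction k with
  | zero => simp
  | succ k ih =>
    have e : (2 : ℝ) ^ (k + 1) * r = 2 * (2 ^ k * r) := by ring
    rw [e] at h ⊢
    calc _ ≤ D * m (Metric.ball x (2 ^ k * r)) := hD.1 x _ (by positivity) h
      _ ≤ D * ((D : ℝ≥0∞) ^ k * m (Metric.ball x r)) := by
        gcongr
        refine ih (ofReal_lt_diamSpace_of_le ?_ h)
        have : 0 < 2 ^ k * r := by positivity
        linarith
      _ = _ := by ring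

theorem exists_two_pow_mul_mem {s t : ℝ} (hs : 0 < s) (hst : s ≤ t) :
    ∃ k : ℕ, t ≤ 2 ^ k * s ∧ 2 ^ k * s ≤ 2 * t := by
  obtain ⟨n, h1, h2⟩ := exists_nat_pow_near ((one_le_div hs).2 hst) (one_lt_two : (1 : ℝ) < 2)
  rw [le_div_iff₀ hs] at h1
  rw [div_lt_iff₀ hs] at h2
  exact ⟨n + 1, h2.le, by rw [pow_succ]; linarith⟩

variable [BorelSpace X]

theorem sum_measure_ball_le {ι : Type*} {Z : Finset ι} {t : ι → X} {r ρ : ℝ} {x : X}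
    (hZ : ∀ z ∈ Z, dist (t z) x < ρ)
    (hsep : ∀ z ∈ Z, ∀ w ∈ Z, z ≠ w → r ≤ dist (t z) (t w)) :
    ∑ z ∈ Z, m (Metric.ball (t z) (r / 2)) ≤ m (Metric.ball x (ρ + r / 2)) := by
  rw [← measure_biUnion_finset]
  · refine measure_mono (iUnion₂_subset fun z hz y hy => ?_)
    rw [Metric.mem_ball] at hy ⊢
    linarith [dist_triangle y (t z) x, hZ z hz]
  · intro z hz w hw hzw
    refine Metric.ball_disjoint_ball ?_
    linarith [hsep z hz w hw hzw]
  · exact fun z _ => measurableSet_ball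

variable [m.IsOpenPosMeasure]

/-- The balls of radius r/2 are disjoint inside B(x, 2ρ), and each carries at least a D^(-k) share
of its volume, since k doublings make it contain B(x, 2ρ). -/
theorem LocallyDoubling.card_le (hD : LocallyDoubling m D) {ι : Type*} {Z : Finset ι} {t : ι → X}
    {r ρ : ℝ} {x : X} (hr : 0 < r) (hrρ : r ≤ ρ) (hZ : ∀ z ∈ Z, dist (t z) x < ρ)
    (hsep : ∀ z ∈ Z, ∀ w ∈ Z, z ≠ w → r ≤ dist (t z) (t w)) {k : ℕ}
    (hk : 4 * ρ ≤ 2 ^ k * (r / 2)) (hd : ENNReal.ofReal (2 ^ k * (r / 2)) < diamSpace X) :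
    (Z.card : ℝ≥0∞) ≤ (D : ℝ≥0∞) ^ k := by
  have h0 : m (Metric.ball x (2 * ρ)) ≠ 0 := (Metric.measure_ball_pos m x (by linarith)).ne'
  have h1 : m (Metric.ball x (2 * ρ)) ≠ ∞ :=
    hD.2 x _ (ofReal_lt_diamSpace_of_le (by linarith) hd)
  have h2 : ∀ z ∈ Z, m (Metric.ball x (2 * ρ)) ≤
      (D : ℝ≥0∞) ^ k * m (Metric.ball (t z) (r / 2)) := fun z hz => by
    refine le_trans (measure_mono fun y hy => ?_) (hD.iterate k (t z) (half_pos hr) hd)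
    rw [Metric.mem_ball] at hy ⊢
    have := dist_triangle_right y (t z) x
    linarith [hZ z hz]
  have h3 : (Z.card : ℝ≥0∞) * m (Metric.ball x (2 * ρ)) ≤
      (D : ℝ≥0∞) ^ k * m (Metric.ball x (2 * ρ)) := by
    calc _ = ∑ z ∈ Z, m (Metric.ball x (2 * ρ)) := by simp
      _ ≤ ∑ z ∈ Z, (D : ℝ≥0∞) ^ k * m (Metric.ball (t z) (r / 2)) := Finset.sum_le_sum h2
      _ = (D : ℝ≥0∞) ^ k * ∑ z ∈ Z, m (Metric.ball (t z) (r / 2)) := by rw [Finset.mul_sum]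
      _ ≤ _ := by
        gcongr
        refine (sum_measure_ball_le hZ hsep).trans (measure_mono (Metric.ball_subset_ball ?_))
        linarith
  exact (ENNReal.mul_le_mul_iff_left h0 h1).1 h3

/-- A separated set of greatest cardinality is a net; the packing bound guarantees that one exists.
-/
theorem LocallyDoubling.exists_net (hD : LocallyDoubling m D) (x : X) {r ρ : ℝ} (hr : 0 < r)
    (hrρ : r ≤ ρ) (hd : ENNReal.ofReal (8 * ρ) < diamSpace X) :
    ∃ Z : Finset X, (∀ z ∈ Z, dist z x < ρ) ∧ (∀ z ∈ Z, ∀ w ∈ Z, z ≠ w → r ≤ dist z w) ∧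
      ∀ y, dist y x < ρ → ∃ z ∈ Z, dist y z < r := by
  classical
  obtain ⟨k, hk1, hk2⟩ := exists_two_pow_mul_mem (s := r / 2) (t := 4 * ρ) (by linarith)
    (by linarith)
  let S : Set ℕ := {n | ∃ Z : Finset X, (∀ z ∈ Z, dist z x < ρ) ∧
    (∀ z ∈ Z, ∀ w ∈ Z, z ≠ w → r ≤ dist z w) ∧ Z.card = n}
  have hS : S.Nonempty := ⟨0, ∅, by simp, by simp, rfl⟩
  have hB : BddAbove S := by
    refine ⟨⌈D ^ k⌉₊, ?_⟩
    rintro _ ⟨Z, h1, h2, rfl⟩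
    have h3 := hD.card_le (t := fun z => z) hr hrρ h1 h2 hk1
      (ofReal_lt_diamSpace_of_le (by linarith) hd)
    have h4 : (Z.card : ℝ≥0) ≤ D ^ k := by exact_mod_cast h3
    exact_mod_cast h4.trans (Nat.le_ceil _)
  obtain ⟨Z, h1, h2, h3⟩ := Nat.sSup_mem hS hB
  refine ⟨Z, h1, h2, fun y hy => ?_⟩
  by_contra! hcon
  have hyZ : y ∉ Z := fun h => by
    have := hcon y h
    rw [dist_self] at this
    linarith
  have : Z.card + 1 ∈ S := by
    refine ⟨insert y Z, ?_, ?_, Finset.card_insert_of_notMem hyZ⟩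
    · intro z hz
      rcases Finset.mem_insert.1 hz with rfl | hz
      exacts [hy, h1 z hz]
    · intro z hz w hw hzw
      rcases Finset.mem_insert.1 hz with hz' | hz' <;>
        rcases Finset.mem_insert.1 hw with hw' | hw'
      · exact absurd (hz'.trans hw'.symm) hzw
      · rw [hz']; exact hcon w hw'
      · rw [hw', dist_comm]; exact hcon z hz'
      · exact h2 z hz' w hw' hzw
  have := le_csSup hB this
  omega

end Doubling

/-! ### The ramp function built from cutoffs at scale r. -/

section Ramp

variable {X : Type*} [MetricSpace X] [MeasurableSpace X] {p : ℝ} {m : Measure X}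
  {𝓔 : PEnergy p m}

theorem PEnergy.coe_sum_ae (s : Finset ℕ) (η : ℕ → 𝓔.dom) : ∀ᵐ x ∂m,
    ((∑ k ∈ s, η k : 𝓔.dom) : LpR p m) x = ∑ k ∈ s, (η k : LpR p m) x := by
  classical
  induction s using Finset.induction_on with
  | empty =>
    filter_upwards [Lp.coeFn_zero ℝ (ENNReal.ofReal p) m] with x hx
    simpa using hx
  | insert k s hk ih =>
    rw [Finset.sum_insert hk, Submodule.coe_add]
    filter_upwards [ih, Lp.coeFn_add (η k : LpR p m) ((∑ k ∈ s, η k : 𝓔.dom) : LpR p m)]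
      with x h1 h2
    rw [h2, Pi.add_apply, h1, Finset.sum_insert hk]

theorem PEnergy.EnergyMeasure.sum_rpow_le (Γ : 𝓔.EnergyMeasure) (hp : 1 < p) (s : Finset ℕ)
    (η : ℕ → 𝓔.dom) {A : Set X} (hA : MeasurableSet A) :
    Γ.Γ (∑ k ∈ s, η k) A ^ (1 / p) ≤ ∑ k ∈ s, Γ.Γ (η k) A ^ (1 / p) := by
  classical
  have hq : 0 < 1 / p := by positivity
  induction s using Finset.induction_on with
  | empty => simp only [Finset.sum_empty]; rw [Γ.zero_apply hp hA, ENNReal.zero_rpow_of_pos hq]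
  | insert k s hk ih =>
    rw [Finset.sum_insert hk, Finset.sum_insert hk]
    exact (Γ.add A hA _ _).trans (by gcongr)

/-- Elements of the domain whose energy measures live on disjoint sets have subadditive energy. -/
theorem PEnergy.EnergyMeasure.sum_univ_le (Γ : 𝓔.EnergyMeasure) (hp : 1 < p) (s : Finset ℕ)
    (η : ℕ → 𝓔.dom) {T : ℕ → Set X} (hT : ∀ k, MeasurableSet (T k))
    (hdisj : Pairwise (Function.onFun Disjoint T)) (hη : ∀ k, Γ.Γ (η k) (T k)ᶜ = 0) :
    Γ.Γ (∑ k ∈ s, η k) univ ≤ ∑ k ∈ s, Γ.Γ (η k) (T k) := by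
  have hq : 0 < 1 / p := by positivity
  have h1 : Γ.Γ (∑ k ∈ s, η k) (⋃ k ∈ s, T k)ᶜ = 0 := by
    have hU : MeasurableSet (⋃ k ∈ s, T k) := s.measurableSet_biUnion fun k _ => hT k
    have h := Γ.sum_rpow_le hp s η hU.compl
    have h0 : ∑ k ∈ s, Γ.Γ (η k) (⋃ k ∈ s, T k)ᶜ ^ (1 / p) = 0 := by
      refine Finset.sum_eq_zero fun k hk => ?_
      have hsub : (⋃ k ∈ s, T k)ᶜ ⊆ (T k)ᶜ :=
        compl_subset_compl.2 (subset_iUnion₂ (s := fun k (_ : k ∈ s) => T k) k hk)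
      rw [measure_mono_null hsub (hη k), ENNReal.zero_rpow_of_pos hq]
    rw [h0, nonpos_iff_eq_zero, ENNReal.rpow_eq_zero_iff_of_pos hq] at h
    exact h
  have h2 : ∀ j ∈ s, Γ.Γ (∑ k ∈ s, η k) (T j) ≤ Γ.Γ (η j) (T j) := by
    intro j hj
    have h := Γ.sum_rpow_le hp s η (hT j)
    have h0 : ∑ k ∈ s, Γ.Γ (η k) (T j) ^ (1 / p) = Γ.Γ (η j) (T j) ^ (1 / p) := by
      refine Finset.sum_eq_single_of_mem j hj fun k _ hkj => ?_
      rw [measure_mono_null (subset_compl_iff_disjoint_right.2 (hdisj hkj.symm)) (hη k),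
        ENNReal.zero_rpow_of_pos hq]
    rw [h0] at h
    exact (ENNReal.rpow_le_rpow_iff hq).1 h
  calc Γ.Γ (∑ k ∈ s, η k) univ
      = Γ.Γ (∑ k ∈ s, η k) ((⋃ k ∈ s, T k) ∪ (⋃ k ∈ s, T k)ᶜ) := by rw [union_compl_self]
    _ ≤ Γ.Γ (∑ k ∈ s, η k) (⋃ k ∈ s, T k) + Γ.Γ (∑ k ∈ s, η k) (⋃ k ∈ s, T k)ᶜ :=
        measure_union_le _ _
    _ = Γ.Γ (∑ k ∈ s, η k) (⋃ k ∈ s, T k) := by rw [h1, add_zero]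
    _ ≤ ∑ k ∈ s, Γ.Γ (∑ k ∈ s, η k) (T k) := measure_biUnion_finset_le _ _
    _ ≤ _ := Finset.sum_le_sum h2

/-- The maximum of the cutoffs over Z. The last clause holds on every Borel set, which allows the
energy to be counted shell by shell. -/
theorem PEnergy.exists_finset_sup [BorelSpace X] [Fact (1 ≤ ENNReal.ofReal p)]
    (Γ : 𝓔.EnergyMeasure) (hp : 1 < p) {ψ : X → 𝓔.dom} {r s : ℝ}
    (h01 : ∀ z, ∀ᵐ y ∂m, 0 ≤ (ψ z : LpR p m) y ∧ (ψ z : LpR p m) y ≤ 1)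
    (hone : ∀ z, ∀ᵐ y ∂m, dist y z < r → (ψ z : LpR p m) y = 1)
    (hzero : ∀ z, ∀ᵐ y ∂m, s ≤ dist y z → (ψ z : LpR p m) y = 0) (Z : Finset X) :
    ∃ η : 𝓔.dom, (∀ᵐ y ∂m, 0 ≤ (η : LpR p m) y ∧ (η : LpR p m) y ≤ 1) ∧
      (∀ᵐ y ∂m, (∃ z ∈ Z, dist y z < r) → (η : LpR p m) y = 1) ∧
      (∀ᵐ y ∂m, (∀ z ∈ Z, s ≤ dist y z) → (η : LpR p m) y = 0) ∧
      ∀ A, MeasurableSet A → Γ.Γ η A ≤ ∑ z ∈ Z, Γ.Γ (ψ z) A := by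
  classical
  induction Z using Finset.induction_on with
  | empty =>
    refine ⟨0, ?_, ?_, ?_, fun A hA => ?_⟩
    · filter_upwards [Lp.coeFn_zero ℝ (ENNReal.ofReal p) m] with x hx
      rw [Submodule.coe_zero, hx]
      simp
    · simp
    · filter_upwards [Lp.coeFn_zero ℝ (ENNReal.ofReal p) m] with x hx
      rw [Submodule.coe_zero, hx]
      simp
    · rw [Γ.zero_apply hp hA]; exact zero_le
  | insert w Z hw ih =>
    obtain ⟨η, e1, e2, e3, e4⟩ := ih
    refine ⟨PEnergy.sup (ψ w) η, ?_, ?_, ?_, fun A hA => ?_⟩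
    · filter_upwards [PEnergy.sup_ae (ψ w) η, h01 w, e1] with y a1 a2 a3
      rw [a1]
      exact ⟨le_max_of_le_left a2.1, max_le a2.2 a3.2⟩
    · filter_upwards [PEnergy.sup_ae (ψ w) η, h01 w, e1, hone w, e2] with y a1 a2 a3 a4 a5
      rintro ⟨z, hz, hyz⟩
      rw [a1]
      rcases Finset.mem_insert.1 hz with rfl | hz
      · rw [a4 hyz, max_eq_left a3.2]
      · rw [a5 ⟨z, hz, hyz⟩, max_eq_right a2.2]
    · filter_upwards [PEnergy.sup_ae (ψ w) η, hzero w, e3] with y a1 a4 a5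
      intro h
      rw [a1, a4 (h w (Finset.mem_insert_self _ _)),
        a5 fun z hz => h z (Finset.mem_insert_of_mem hz), max_self]
    · rw [Finset.sum_insert hw]
      exact (Γ.sup_le hp _ _ hA).trans (by gcongr; exact e4 A hA)

theorem PEnergy.exists_cutoff [m.IsOpenPosMeasure] {Ψ : ℝ≥0 → ℝ≥0} {C A : ℝ≥0}
    (hC : 0 < C) {x : X} {r : ℝ≥0} (hr : 0 < r)
    (hcap : 𝓔.cap (Metric.ball x r) (Metric.ball x (A * r))ᶜ ≤ C * (m (Metric.ball x r) / Ψ r))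
    (hΨ : Ψ r ≠ 0) (hm : m (Metric.ball x r) ≠ ∞) :
    ∃ ψ : 𝓔.dom, (∀ᵐ y ∂m, 0 ≤ (ψ : LpR p m) y ∧ (ψ : LpR p m) y ≤ 1) ∧
      (∀ᵐ y ∂m, dist y x < r → (ψ : LpR p m) y = 1) ∧
      (∀ᵐ y ∂m, (A * r : ℝ) ≤ dist y x → (ψ : LpR p m) y = 0) ∧
      (𝓔.energy ψ : ℝ≥0∞) ≤ 2 * C * (m (Metric.ball x r) / Ψ r) := by
  set c : ℝ≥0∞ := C * (m (Metric.ball x r) / Ψ r) with hc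
  have hm0 : m (Metric.ball x r) ≠ 0 := (Metric.measure_ball_pos m x (by exact_mod_cast hr)).ne'
  have hc0 : c ≠ 0 := by
    have : (C : ℝ≥0∞) ≠ 0 := by exact_mod_cast hC.ne'
    rw [hc, mul_ne_zero_iff]
    exact ⟨this, ENNReal.div_ne_zero.2 ⟨hm0, ENNReal.coe_ne_top⟩⟩
  have hct : c ≠ ∞ :=
    ENNReal.mul_ne_top ENNReal.coe_ne_top (ENNReal.div_ne_top hm (by exact_mod_cast hΨ))
  -- The infimum need not be attained; doubling a positive finite bound leaves room for an
  -- admissible function.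
  have hlt : 𝓔.cap (Metric.ball x r) (Metric.ball x (A * r))ᶜ < 2 * c := by
    refine hcap.trans_lt ?_
    rw [two_mul]
    exact ENNReal.lt_add_right hct hc0
  unfold PEnergy.cap at hlt
  obtain ⟨φ, hφ⟩ := iInf_lt_iff.1 hlt
  obtain ⟨⟨⟨U, -, hU1, hU2⟩, V, -, hV1, hV2⟩, hE⟩ := iInf_lt_iff.1 hφ
  refine ⟨PEnergy.clamp φ, ?_, ?_, ?_, ?_⟩
  · filter_upwards [PEnergy.clamp_ae φ] with y h1
    rw [h1]
    exact ⟨unitClamp_nonneg _, unitClamp_le_one _⟩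
  · filter_upwards [PEnergy.clamp_ae φ, hU2] with y h1 h2 hy
    rw [h1, h2 (hU1 hy), unitClamp_of_one_le le_rfl]
  · filter_upwards [PEnergy.clamp_ae φ, hV2] with y h1 h2 hy
    rw [h1, h2 (hV1 fun h => absurd (Metric.mem_ball.1 h) (not_lt.2 hy)),
      unitClamp_of_nonpos le_rfl]
  · rw [mul_assoc]
    refine le_trans ?_ hE.le
    exact_mod_cast PEnergy.energy_comp_le lipschitzWith_unitClamp unitClamp_zero φ

/-- A function that decreases from one to zero across an annulus of width at least
`N * ((A + 3) * r)` in `N` equal steps, made of cutoff functions at scale `r`. -/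
theorem PEnergy.exists_ramp [BorelSpace X] [LocallyCompactSpace X] [SecondCountableTopology X]
    [m.IsOpenPosMeasure] [Fact (1 ≤ ENNReal.ofReal p)] (Γ : 𝓔.EnergyMeasure) (hp : 1 < p)
    {D : ℝ≥0} (hD : LocallyDoubling m D) {Ψ : ℝ≥0 → ℝ≥0} {C A : ℝ≥0} (hC : 0 < C)
    (hcap : ∀ (x : X) (r : ℝ≥0), 0 < r →
      𝓔.cap (Metric.ball x r) (Metric.ball x (A * r))ᶜ ≤ C * (m (Metric.ball x r) / Ψ r))
    (x : X) {r : ℝ≥0} {a b : ℝ} {N : ℕ} (hr : 0 < r) (hΨ : Ψ r ≠ 0) (ha : 0 ≤ a) (hN : 0 < N)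
    (hab : a + N * ((A + 3) * r) ≤ b) (hb : ENNReal.ofReal (8 * b) < diamSpace X) :
    ∃ f : 𝓔.dom, (∀ᵐ y ∂m, dist y x < a + r → (f : LpR p m) y = 1) ∧
      (∀ᵐ y ∂m, b - r < dist y x → (f : LpR p m) y = 0) ∧
      (N : ℝ≥0∞) ^ p * 𝓔.energy f ≤ 2 * C * D * (m (Metric.ball x (2 * b)) / Ψ r) := by
  classical
  have hr' : (0 : ℝ) < r := by exact_mod_cast hr
  have hA : (0 : ℝ) ≤ A := A.2
  -- Width of a shell: A r for the fall of the cutoffs, 2r for the overshoot of the selected net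
  -- points, and a margin r at the outer edge. The cutoffs are also 1 up to r beyond the inner edge.
  set ℓ : ℝ := (A + 3) * r with hℓ
  have hℓ0 : 0 < ℓ := by positivity
  have hrℓ : (r : ℝ) ≤ ℓ := by rw [hℓ]; nlinarith
  have hN' : (0 : ℝ) < N := by exact_mod_cast hN
  have hN1 : (1 : ℝ) ≤ N := by exact_mod_cast hN
  have hrb : (r : ℝ) ≤ b := by nlinarith
  have hrd : ENNReal.ofReal r < diamSpace X := ofReal_lt_diamSpace_of_le (by linarith) hb
  obtain ⟨Z, hZ1, hZ2, hZ3⟩ := hD.exists_net x hr' hrb hb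
  choose ψ hψ01 hψ1 hψ0 hψE using fun z => PEnergy.exists_cutoff (𝓔 := 𝓔) hC hr (hcap z r hr) hΨ
    (hD.2 z _ hrd)
  choose η hη01 hη1 hη0 hηΓ using fun k : ℕ => PEnergy.exists_finset_sup Γ hp hψ01 hψ1 hψ0
    (Z.filter fun z => dist z x < a + k * ℓ + 2 * r)
  have hklt : ∀ k l : ℕ, k < l → (k : ℝ) * ℓ + ℓ ≤ l * ℓ := fun k l h => by
    have : (k : ℝ) + 1 ≤ l := by exact_mod_cast h
    nlinarith
  let T : ℕ → Set X := fun k => {y | a + k * ℓ ≤ dist y x} ∩ {y | dist y x < a + k * ℓ + ℓ}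
  have hmem : ∀ k y, y ∈ T k ↔ a + k * ℓ ≤ dist y x ∧ dist y x < a + k * ℓ + ℓ :=
    fun _ _ => Iff.rfl
  have hT : ∀ k, MeasurableSet (T k) := fun k =>
    (isClosed_le continuous_const (by fun_prop)).measurableSet.inter
      (isOpen_lt (by fun_prop) continuous_const).measurableSet
  have hdisj : Pairwise (Function.onFun Disjoint T) := by
    have : ∀ k l, k < l → Disjoint (T k) (T l) := fun k l h => by
      rw [Set.disjoint_left]
      intro y h1 h2
      rw [hmem] at h1 h2
      linarith [h1.2, h2.1, hklt k l h]
    intro k l h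
    rcases lt_or_gt_of_ne h with h | h
    exacts [this k l h, (this l k h).symm]
  have hone : ∀ k < N, ∀ᵐ y ∂m, dist y x < a + k * ℓ + r → (η k : LpR p m) y = 1 := by
    intro k hk
    filter_upwards [hη1 k] with y h1 hy
    have := hklt k N hk
    obtain ⟨z, hz, hyz⟩ := hZ3 y (by linarith)
    refine h1 ⟨z, Finset.mem_filter.2 ⟨hz, ?_⟩, hyz⟩
    linarith [dist_triangle_left z x y]
  have hzero : ∀ k : ℕ, ∀ᵐ y ∂m, a + k * ℓ + ℓ - r < dist y x → (η k : LpR p m) y = 0 := by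
    intro k
    filter_upwards [hη0 k] with y h1 hy
    refine h1 fun z hz => ?_
    have h2 := (Finset.mem_filter.1 hz).2
    have := dist_triangle y z x
    have e : ℓ = A * r + 3 * r := by rw [hℓ]; ring
    linarith
  have hsupp : ∀ k < N, Γ.Γ (η k) (T k)ᶜ = 0 := by
    intro k hk
    have h1 := Γ.eq_zero_of_ae_one hp (hη01 k) (U := {y | dist y x < a + k * ℓ + r})
      (isOpen_lt (by fun_prop) continuous_const) (hone k hk)
    have h2 := Γ.eq_zero_of_ae_zero hp (hη01 k) (U := {y | a + k * ℓ + ℓ - r < dist y x})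
      (isOpen_lt continuous_const (by fun_prop)) (hzero k)
    refine measure_mono_null (fun y hy => ?_) (measure_union_null h1 h2)
    by_cases h : dist y x < a + k * ℓ + r
    · exact Or.inl h
    · refine Or.inr ?_
      change a + k * ℓ + ℓ - r < dist y x
      by_contra h'
      refine hy ((hmem k y).2 ⟨?_, ?_⟩) <;> linarith
  -- The net covers only B(x, b), so the support property is known only for k < N; setting the other
  -- terms to zero gives it for all k.
  let η' : ℕ → 𝓔.dom := fun k => if k < N then η k else 0
  have hη' : ∀ k ∈ Finset.range N, η' k = η k := fun k hk => if_pos (Finset.mem_range.1 hk)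
  have hsupp' : ∀ k, Γ.Γ (η' k) (T k)ᶜ = 0 := by
    intro k
    by_cases hk : k < N
    · simp only [η', if_pos hk]; exact hsupp k hk
    · simp only [η', if_neg hk]; exact Γ.zero_apply hp (hT k).compl
  -- A cutoff may enter many η k, but on each shell only its energy there is charged; disjointness
  -- then bounds its total contribution by its full energy.
  have hsum : Γ.Γ (∑ k ∈ Finset.range N, η k) univ ≤ ∑ z ∈ Z, (𝓔.energy (ψ z) : ℝ≥0∞) := by
    calc Γ.Γ (∑ k ∈ Finset.range N, η k) univ
        = Γ.Γ (∑ k ∈ Finset.range N, η' k) univ := by rw [Finset.sum_congr rfl hη']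
      _ ≤ ∑ k ∈ Finset.range N, Γ.Γ (η' k) (T k) := Γ.sum_univ_le hp _ _ hT hdisj hsupp'
      _ = ∑ k ∈ Finset.range N, Γ.Γ (η k) (T k) :=
        Finset.sum_congr rfl fun k hk => by rw [hη' k hk]
      _ ≤ ∑ k ∈ Finset.range N, ∑ z ∈ Z, Γ.Γ (ψ z) (T k) := by
        refine Finset.sum_le_sum fun k _ => (hηΓ k (T k) (hT k)).trans ?_
        exact Finset.sum_le_sum_of_subset (Finset.filter_subset _ _)
      _ = ∑ z ∈ Z, ∑ k ∈ Finset.range N, Γ.Γ (ψ z) (T k) := Finset.sum_comm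
      _ ≤ _ := by
        refine Finset.sum_le_sum fun z _ => ?_
        rw [← measure_biUnion_finset (hdisj.set_pairwise _) (fun k _ => hT k), ← Γ.total]
        exact measure_mono (subset_univ _)
  have hbound : ∑ z ∈ Z, (𝓔.energy (ψ z) : ℝ≥0∞) ≤
      2 * C * D * (m (Metric.ball x (2 * b)) / Ψ r) := by
    calc ∑ z ∈ Z, (𝓔.energy (ψ z) : ℝ≥0∞)
        ≤ ∑ z ∈ Z, 2 * C * D / Ψ r * m (Metric.ball z (r / 2)) := by
          refine Finset.sum_le_sum fun z _ => (hψE z).trans ?_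
          have h := hD.1 z (r / 2) (by positivity) (by
            rw [mul_div_cancel₀ _ (two_ne_zero)]; exact hrd)
          rw [mul_div_cancel₀ _ (two_ne_zero)] at h
          calc 2 * C * (m (Metric.ball z r) / Ψ r)
              ≤ 2 * C * (D * m (Metric.ball z (r / 2)) / Ψ r) := by gcongr
            _ = _ := by simp only [div_eq_mul_inv]; ring
      _ = 2 * C * D / Ψ r * ∑ z ∈ Z, m (Metric.ball z (r / 2)) := by rw [Finset.mul_sum]
      _ ≤ 2 * C * D / Ψ r * m (Metric.ball x (2 * b)) := by
          gcongr
          refine (sum_measure_ball_le (t := fun z => z) hZ1 hZ2).trans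
            (measure_mono (Metric.ball_subset_ball ?_))
          linarith
      _ = _ := by simp only [div_eq_mul_inv]; ring
  refine ⟨(N : ℝ)⁻¹ • ∑ k ∈ Finset.range N, η k, ?_, ?_, ?_⟩
  · filter_upwards [ae_all_iff.2 fun k => ae_all_iff.2 (hone k),
      PEnergy.coe_sum_ae (Finset.range N) η,
      Lp.coeFn_smul (N : ℝ)⁻¹ ((∑ k ∈ Finset.range N, η k : 𝓔.dom) : LpR p m)]
      with y h1 h2 h3 hy
    rw [Submodule.coe_smul, h3, Pi.smul_apply, h2, Finset.sum_congr rfl fun k hk =>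
      h1 k (Finset.mem_range.1 hk) ?_]
    · simp [hN.ne']
    · have : 0 ≤ (k : ℝ) * ℓ := by positivity
      linarith
  · filter_upwards [ae_all_iff.2 hzero, PEnergy.coe_sum_ae (Finset.range N) η,
      Lp.coeFn_smul (N : ℝ)⁻¹ ((∑ k ∈ Finset.range N, η k : 𝓔.dom) : LpR p m)]
      with y h1 h2 h3 hy
    rw [Submodule.coe_smul, h3, Pi.smul_apply, h2, Finset.sum_eq_zero fun k hk => h1 k ?_,
      smul_zero]
    linarith [hklt k N (Finset.mem_range.1 hk)]
  · have e : (N : ℝ≥0∞) ^ p * 𝓔.energy ((N : ℝ)⁻¹ • ∑ k ∈ Finset.range N, η k) =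
        Γ.Γ (∑ k ∈ Finset.range N, η k) univ := by
      have h1 := Γ.smul_apply hp MeasurableSet.univ (N : ℝ)
        ((N : ℝ)⁻¹ • ∑ k ∈ Finset.range N, η k)
      rw [smul_inv_smul₀ hN'.ne'] at h1
      rw [h1, Γ.total]
      congr 2
      simp
    rw [e]
    exact hsum.trans hbound

end Ramp

/-! ### Consequences of the power growth of Ψ. -/

section Scaling

variable {Ψ : ℝ≥0 → ℝ≥0}

/-- If Ψ r were 0, the quotient Ψ r / Ψ r would be 0 by convention, against the lower growth bound
at R = r. -/
theorem HasPowerGrowth.pos (h : HasPowerGrowth Ψ) {r : ℝ≥0} (hr : 0 < r) : 0 < Ψ r := by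
  obtain ⟨C, β₁, β₂, hC, -, -, H⟩ := h
  have h1 := (H r r hr le_rfl).1
  have hr' : (0 : ℝ) < r := by exact_mod_cast hr
  rw [div_self hr'.ne', Real.one_rpow, mul_one] at h1
  rw [pos_iff_ne_zero]
  intro h0
  rw [h0] at h1
  simp at h1
  linarith

theorem HasPowerGrowth.exists_le (h : HasPowerGrowth Ψ) :
    ∃ C : ℝ, 0 < C ∧ ∀ r R : ℝ≥0, 0 < r → r ≤ R → (Ψ r : ℝ) ≤ C * Ψ R := by
  have hpos := @h.pos
  obtain ⟨C, β₁, β₂, hC, hβ, -, H⟩ := h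
  refine ⟨C, hC, fun r R hr hrR => ?_⟩
  have h1 := (H r R hr hrR).1
  have hr' : (0 : ℝ) < r := by exact_mod_cast hr
  have hΨ : (0 : ℝ) < Ψ r := by exact_mod_cast hpos hr
  have h2 : 1 ≤ ((R : ℝ) / r) ^ β₁ :=
    Real.one_le_rpow ((one_le_div hr').2 (by exact_mod_cast hrR)) hβ.le
  have h3 : C⁻¹ ≤ (Ψ R : ℝ) / Ψ r :=
    le_trans (le_mul_of_one_le_right (by positivity) h2) h1
  rw [le_div_iff₀ hΨ] at h3
  calc (Ψ r : ℝ) = C * (C⁻¹ * Ψ r) := by field_simp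
    _ ≤ C * Ψ R := by gcongr

theorem HasPowerGrowth.exists_le_of_le_mul (h : HasPowerGrowth Ψ) {lam : ℝ} (hlam : 0 < lam) :
    ∃ C : ℝ, 0 < C ∧ ∀ r R : ℝ≥0, 0 < r → r ≤ R → (R : ℝ) ≤ lam * r →
      (Ψ R : ℝ) ≤ C * Ψ r := by
  have hpos := @h.pos
  obtain ⟨C, β₁, β₂, hC, hβ, hβ', H⟩ := h
  refine ⟨C * lam ^ β₂, by positivity, fun r R hr hrR hR => ?_⟩
  have h1 := (H r R hr hrR).2
  have hr' : (0 : ℝ) < r := by exact_mod_cast hr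
  have hΨ : (0 : ℝ) < Ψ r := by exact_mod_cast hpos hr
  have hβ₂ : 0 ≤ β₂ := by linarith
  have h2 : (R : ℝ) / r ≤ lam := by rwa [div_le_iff₀ hr']
  rw [div_le_iff₀ hΨ] at h1
  refine h1.trans ?_
  gcongr

/-- It suffices to prove the lower bound for radii that are small with respect to the diameter
and well separated from each other. -/
theorem HasPowerGrowth.lower_bound_of_small (h : HasPowerGrowth Ψ) {p : ℝ} (hp : 1 < p)
    {d : ℝ≥0∞} {S κ K : ℝ} (hS : 1 ≤ S) (hκ : 0 < κ) (hK : 0 < K)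
    (H : ∀ r R : ℝ≥0, 0 < r → (r : ℝ) ≤ κ * R → ENNReal.ofReal (S * R) < d →
      ((R : ℝ) / r) ^ p * Ψ r ≤ K * Ψ R) :
    ∃ C : ℝ, 0 < C ∧ ∀ r R : ℝ≥0, 0 < r → r ≤ R → (R : ℝ≥0∞) < d →
      1 / C * ((R : ℝ) / r) ^ p ≤ (Ψ R : ℝ) / Ψ r := by
  obtain ⟨C, hC, hΨC⟩ := h.exists_le
  have hS0 : 0 < S := by linarith
  refine ⟨S ^ p * K * C + (S / κ) ^ p * C, by positivity, fun r R hr hrR hR => ?_⟩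
  have hr' : (0 : ℝ) < r := by exact_mod_cast hr
  have hR' : (0 : ℝ) < R := by exact_mod_cast hr.trans_le hrR
  have hΨr : (0 : ℝ) < Ψ r := by exact_mod_cast h.pos hr
  have hΨR : (0 : ℝ) < Ψ R := by exact_mod_cast h.pos (hr.trans_le hrR)
  rw [le_div_iff₀ hΨr, one_div, mul_assoc, inv_mul_le_iff₀ (by positivity), add_mul]
  -- If r ≤ κ R' the hypothesis applies at R'; otherwise R / r is at most S / κ and almost
  -- monotonicity of Ψ suffices.
  set R' : ℝ≥0 := R / S.toNNReal with hR'def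
  have hRS : (R' : ℝ) = R / S := by rw [hR'def]; simp [hS0.le]
  have hR'R : R' ≤ R := by
    rw [← NNReal.coe_le_coe, hRS]
    exact div_le_self hR'.le hS
  by_cases hrk : (r : ℝ) ≤ κ * R'
  · have h1 := H r R' hr hrk (by
      rw [hRS, mul_div_cancel₀ _ hS0.ne', ENNReal.ofReal_coe_nnreal]; exact hR)
    have hR'0 : 0 < R' := by
      rw [← NNReal.coe_pos, hRS]; positivity
    have h2 : ((R : ℝ) / r) ^ p = S ^ p * ((R' : ℝ) / r) ^ p := by
      rw [← Real.mul_rpow hS0.le (by positivity), hRS]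
      congr 1
      field_simp
    calc ((R : ℝ) / r) ^ p * Ψ r = S ^ p * (((R' : ℝ) / r) ^ p * Ψ r) := by rw [h2]; ring
      _ ≤ S ^ p * (K * (C * Ψ R)) := by
        have h3 := hΨC _ _ hR'0 hR'R
        exact mul_le_mul_of_nonneg_left (h1.trans (by gcongr)) (by positivity)
      _ = S ^ p * K * C * Ψ R := by ring
      _ ≤ _ := le_add_of_nonneg_right (by positivity)
  · have h1 : (R : ℝ) / r ≤ S / κ := by
      rw [not_le, hRS] at hrk
      rw [div_le_div_iff₀ hr' hκ]
      calc (R : ℝ) * κ = S * (κ * (R / S)) := by field_simp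
        _ ≤ S * r := by gcongr
    calc ((R : ℝ) / r) ^ p * Ψ r ≤ (S / κ) ^ p * (C * Ψ R) := by
          gcongr
          exact hΨC _ _ hr hrR
      _ = (S / κ) ^ p * C * Ψ R := by ring
      _ ≤ _ := le_add_of_nonneg_left (by positivity)

theorem natCast_rpow_mul_le {p : ℝ} (hp : 0 ≤ p) {N : ℕ} {K a b : ℝ≥0} {V : ℝ≥0∞}
    (hV0 : V ≠ 0) (hV : V ≠ ∞) (hb : b ≠ 0)
    (h : (N : ℝ≥0∞) ^ p * V ≤ K * a * (V / b)) : (N : ℝ) ^ p * b ≤ K * a := by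
  lift V to ℝ≥0 using hV
  have hV0' : 0 < V := pos_iff_ne_zero.2 (by exact_mod_cast hV0)
  have h1 : (N : ℝ≥0∞) ^ p = (((N : ℝ≥0) ^ p : ℝ≥0) : ℝ≥0∞) := by
    rw [ENNReal.coe_rpow_of_nonneg _ hp]; simp
  rw [h1, ← ENNReal.coe_div hb] at h
  have h2 : (N : ℝ≥0) ^ p * V ≤ K * a * (V / b) := by exact_mod_cast h
  have h3 : (N : ℝ≥0) ^ p * b ≤ K * a := by
    have hb' : 0 < b := pos_iff_ne_zero.2 hb
    refine le_of_mul_le_mul_right ?_ (div_pos hV0' hb')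
    calc (N : ℝ≥0) ^ p * b * (V / b) = (N : ℝ≥0) ^ p * V := by field_simp
      _ ≤ _ := h2
  exact_mod_cast h3

end Scaling

/-! ### Bounded overlap and chains of points. -/

section Chains

theorem sum_measure_le_of_card_le {X : Type*} [MeasurableSpace X] {ι : Type*} (μ : Measure X) (Z : Finset ι)
    {B : ι → Set X} (hB : ∀ i, MeasurableSet (B i)) {M : ℝ≥0∞} [∀ y, DecidablePred fun i => y ∈ B i]
    (hM : ∀ y, ((Z.filter fun i => y ∈ B i).card : ℝ≥0∞) ≤ M) :
    ∑ i ∈ Z, μ (B i) ≤ M * μ univ := by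
  calc ∑ i ∈ Z, μ (B i) = ∑ i ∈ Z, ∫⁻ y, (B i).indicator 1 y ∂μ :=
        Finset.sum_congr rfl fun i _ => (lintegral_indicator_one (hB i)).symm
    _ = ∫⁻ y, ∑ i ∈ Z, (B i).indicator 1 y ∂μ :=
        (lintegral_finsetSum _ fun i _ => measurable_one.indicator (hB i)).symm
    _ ≤ ∫⁻ _, M ∂μ := by
        refine lintegral_mono fun y => ?_
        refine le_trans (le_of_eq ?_) (hM y)
        simp [Set.indicator_apply]
    _ = M * μ univ := lintegral_const _

variable {X : Type*} [MetricSpace X]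

/-- As 2s is below the diameter, some point lies at distance at least s from x. On a chain to it
with steps shorter than δ, the first point outside B(x, s) works. -/
theorem ChainCondition.exists_dist_mem (h : ChainCondition X) (x : X) {s δ : ℝ} (hs : 0 < s)
    (hδ : 0 < δ) (hd : ENNReal.ofReal (2 * s) < diamSpace X) :
    ∃ y, s ≤ dist y x ∧ dist y x < s + δ := by
  classical
  obtain ⟨w, hw⟩ : ∃ w, s ≤ dist w x := by
    by_contra! hcon
    refine absurd hd (not_lt.2 (Metric.ediam_le fun y _ z _ => ?_))
    rw [edist_dist]
    refine ENNReal.ofReal_le_ofReal ?_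
    linarith [dist_triangle_right y z x, hcon y, hcon z]
  obtain ⟨C, hC, H⟩ := h
  obtain ⟨n, hn⟩ := exists_nat_gt (C * dist x w / δ)
  obtain ⟨t, ht0, htn, ht⟩ := H x w (n + 1) n.succ_pos
  have hstep : C * (dist x w / ((n + 1 : ℕ) : ℝ)) < δ := by
    rw [← mul_div_assoc, div_lt_iff₀ (by positivity)]
    rw [div_lt_iff₀ hδ] at hn
    push_cast
    nlinarith
  have hex : ∃ k, s ≤ dist (t k) x := ⟨n + 1, by rw [htn]; exact hw⟩
  have hk := Nat.find_spec hex
  have hkmin := fun {j} => Nat.find_min hex (m := j)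
  set k := Nat.find hex with hkdef
  have hkn : k ≤ n + 1 := Nat.find_min' hex (by rw [htn]; exact hw)
  clear_value k
  rcases k with - | k
  · rw [ht0, dist_self] at hk; linarith
  · refine ⟨t (k + 1), hk, ?_⟩
    have h1 := not_le.1 (hkmin (Nat.lt_succ_self k))
    have h2 := ht k hkn
    linarith [dist_triangle (t (k + 1)) (t k) x]

/-- Erasing loops from a chain makes its points separated. -/
theorem exists_separated_chain {r : ℝ} (hr : 0 < r) (n : ℕ) : ∀ s : ℕ → X,
    (∀ k < n, dist (s (k + 1)) (s k) ≤ r) → ∃ l ≤ n, ∃ t : ℕ → X, t 0 = s 0 ∧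
      dist (t l) (s n) ≤ r ∧ (∀ i < l, dist (t (i + 1)) (t i) ≤ 2 * r) ∧
      (∀ i ≤ l, ∀ j ≤ l, i ≠ j → r ≤ dist (t i) (t j)) ∧ ∀ i ≤ l, ∃ k ≤ n, t i = s k := by
  classical
  induction n using Nat.strong_induction_on with
  | _ n ih =>
  intro s hs
  -- Take the last j with s j within r of the start. The next point is within 2r of the start and
  -- all later ones are farther than r, so the recursion continues from j + 1.
  let P : ℕ → Prop := fun j => dist (s j) (s 0) ≤ r
  have hP0 : P 0 := by simp [P, hr.le]
  have hPj := Nat.findGreatest_spec (P := P) (Nat.zero_le n) hP0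
  have hjn : Nat.findGreatest P n ≤ n := Nat.findGreatest_le n
  have hgt : ∀ k, Nat.findGreatest P n < k → k ≤ n → ¬ P k := fun k h1 h2 =>
    Nat.findGreatest_is_greatest h1 h2
  set j := Nat.findGreatest P n
  clear_value j
  rcases hjn.eq_or_lt with rfl | hjn
  · refine ⟨0, Nat.zero_le _, fun _ => s 0, rfl, ?_, by simp, ?_, fun i _ => ⟨0, by simp⟩⟩
    · rw [dist_comm]; exact hPj
    · intro i hi k hk hik
      omega
  · obtain ⟨l, hl, t, ht0, htl, ht1, ht2, ht3⟩ := ih (n - (j + 1)) (by omega)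
      (fun k => s (k + (j + 1))) (fun k hk => by
        have := hs (k + (j + 1)) (by omega)
        convert this using 3
        ring)
    have hfar : ∀ i ≤ l, r ≤ dist (t i) (s 0) := fun i hi => by
      obtain ⟨k, hk, hik⟩ := ht3 i hi
      rw [hik]
      exact (not_le.1 (hgt (k + (j + 1)) (by omega) (by omega))).le
    refine ⟨l + 1, by omega, fun i => if i = 0 then s 0 else t (i - 1), by simp, ?_, ?_, ?_, ?_⟩
    · have e : n - (j + 1) + (j + 1) = n := by omega
      simpa [e] using htl
    · intro i hi
      rcases i with - | i
      · simp only [zero_add, one_ne_zero, if_false, if_true, Nat.sub_self]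
        rw [ht0, zero_add]
        have h1 := hs j hjn
        have h2 : dist (s j) (s 0) ≤ r := hPj
        linarith [dist_triangle (s (j + 1)) (s j) (s 0)]
      · simpa using ht1 i (by omega)
    · intro i hi k hk hik
      rcases i with - | i <;> rcases k with - | k
      · exact absurd rfl hik
      · simp only [if_true, Nat.succ_ne_zero, if_false, Nat.add_sub_cancel]
        rw [dist_comm]
        exact hfar k (by omega)
      · simp only [if_true, Nat.succ_ne_zero, if_false, Nat.add_sub_cancel]
        exact hfar i (by omega)
      · simp only [Nat.succ_ne_zero, if_false, Nat.add_sub_cancel]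
        exact ht2 i (by omega) k (by omega) (by omega)
    · intro i hi
      rcases i with - | i
      · exact ⟨0, by omega, by simp⟩
      · obtain ⟨k, hk, hik⟩ := ht3 i (by omega)
        exact ⟨k + (j + 1), by omega, by simpa using hik⟩

end Chains

/-! ### Local doubling from either volume condition. -/

section Volume

variable {X : Type*} [MetricSpace X] [MeasurableSpace X] {m : Measure X}

/-- Small balls have finite measure by local finiteness, and doubling propagates this to all balls.
-/
theorem VolumeDoubling.locallyDoubling [IsLocallyFiniteMeasure m] (h : VolumeDoubling m) :
    ∃ D : ℝ≥0, LocallyDoubling m D := by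
  obtain ⟨D, -, H⟩ := h
  have H' : ∀ (x : X) (r : ℝ), 0 < r → m (Metric.ball x (2 * r)) ≤ D * m (Metric.ball x r) := by
    intro x r hr
    simpa [hr.le] using H x r.toNNReal (by simpa using hr)
  refine ⟨D, fun x r hr _ => H' x r hr, fun x r _ => ?_⟩
  obtain ⟨U, hU, hmU⟩ := m.finiteAt_nhds x
  obtain ⟨s, hs, hsU⟩ := Metric.mem_nhds_iff.1 hU
  have hfin : ∀ k : ℕ, m (Metric.ball x (2 ^ k * s)) ≠ ∞ := by
    intro k
    induction k with
    | zero => simpa using ((measure_mono hsU).trans_lt hmU).ne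
    | succ k ih =>
      have e : (2 : ℝ) ^ (k + 1) * s = 2 * (2 ^ k * s) := by ring
      rw [e]
      exact ne_top_of_le_ne_top (ENNReal.mul_ne_top ENNReal.coe_ne_top ih)
        (H' x _ (by positivity))
  obtain ⟨k, hk⟩ := pow_unbounded_of_one_lt (r / s) (one_lt_two : (1 : ℝ) < 2)
  rw [div_lt_iff₀ hs] at hk
  exact ne_top_of_le_ne_top (hfin k) (measure_mono (Metric.ball_subset_ball hk.le))

theorem VolumeRegular.locallyDoubling {Φ : ℝ≥0 → ℝ≥0} (h : VolumeRegular m Φ)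
    (hΦ : IsDoubling Φ) : ∃ D : ℝ≥0, LocallyDoubling m D := by
  obtain ⟨K, hK, H⟩ := h
  obtain ⟨-, C, -, hC⟩ := hΦ
  have hK0 : (K : ℝ≥0∞) ≠ 0 := by exact_mod_cast hK.ne'
  refine ⟨K * C * K, fun x r hr hd => ?_, fun x r hd => ?_⟩
  · have hr0 : 0 < r.toNNReal := by simpa using hr
    have e2 : ENNReal.ofReal (2 * r) = ((2 * r.toNNReal : ℝ≥0) : ℝ≥0∞) := by
      rw [ENNReal.ofReal, Real.toNNReal_mul (by norm_num)]; simp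
    have h1 := (H x (2 * r.toNNReal) (by positivity) (by rw [← e2]; exact hd)).2
    have h2 := (H x r.toNNReal hr0 (ofReal_lt_diamSpace_of_le (by linarith) hd)).1
    have e3 : ((2 * r.toNNReal : ℝ≥0) : ℝ) = 2 * r := by simp [hr.le]
    rw [e3] at h1
    rw [Real.coe_toNNReal _ hr.le] at h2
    rw [ENNReal.div_le_iff hK0 ENNReal.coe_ne_top] at h2
    calc m (Metric.ball x (2 * r)) ≤ K * Φ (2 * r.toNNReal) := h1
      _ ≤ K * (C * (m (Metric.ball x r) * K)) := by
        gcongr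
        calc (Φ (2 * r.toNNReal) : ℝ≥0∞) ≤ ((C * Φ r.toNNReal : ℝ≥0) : ℝ≥0∞) := by
              exact_mod_cast hC _ hr0
          _ ≤ _ := by push_cast; gcongr
      _ = _ := by push_cast; ring
  · rcases le_or_gt r 0 with hr | hr
    · simp [Metric.ball_eq_empty.2 hr]
    · have h1 := (H x r.toNNReal (by simpa using hr) hd).2
      rw [Real.coe_toNNReal _ hr.le] at h1
      exact ne_top_of_le_ne_top (by finiteness) h1

/-- Almost monotonicity of Φ, read off from the monotonicity of ball volumes. -/
theorem VolumeRegular.exists_le [Nonempty X] {Φ : ℝ≥0 → ℝ≥0} (h : VolumeRegular m Φ) :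
    ∃ C : ℝ, 0 < C ∧ ∀ r R : ℝ≥0, 0 < r → r ≤ R → (R : ℝ≥0∞) < diamSpace X →
      (Φ r : ℝ) ≤ C * Φ R := by
  obtain ⟨K, hK, H⟩ := h
  obtain ⟨x⟩ := ‹Nonempty X›
  have hK0 : (K : ℝ≥0∞) ≠ 0 := by exact_mod_cast hK.ne'
  refine ⟨K * K, by positivity, fun r R hr hrR hd => ?_⟩
  have h1 := (H x r hr (lt_of_le_of_lt (by exact_mod_cast hrR) hd)).1
  have h2 := (H x R (hr.trans_le hrR) hd).2
  rw [ENNReal.div_le_iff hK0 ENNReal.coe_ne_top] at h1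
  have h3 : (Φ r : ℝ≥0∞) ≤ ((K * K * Φ R : ℝ≥0) : ℝ≥0∞) := by
    calc (Φ r : ℝ≥0∞) ≤ m (Metric.ball x r) * K := h1
      _ ≤ (K * Φ R) * K := by
        gcongr
        exact (measure_mono (Metric.ball_subset_ball (by exact_mod_cast hrR))).trans h2
      _ = _ := by push_cast; ring
  exact_mod_cast h3

variable [m.IsOpenPosMeasure]

theorem VolumeRegular.pos [Nonempty X] {Φ : ℝ≥0 → ℝ≥0} (h : VolumeRegular m Φ) {r : ℝ≥0}
    (hr : 0 < r) (hd : (r : ℝ≥0∞) < diamSpace X) : 0 < Φ r := by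
  obtain ⟨K, hK, H⟩ := h
  obtain ⟨x⟩ := ‹Nonempty X›
  have h1 := (H x r hr hd).2
  have h2 := Metric.measure_ball_pos m x (r := r) (by exact_mod_cast hr)
  rw [pos_iff_ne_zero]
  intro h0
  rw [h0] at h1
  simp at h1
  exact h2.ne' h1

end Volume

/-! ### The lower bound, from the Poincaré inequality or from capacities. -/

section LowerBounds

theorem enorm_const_sub_mul_le {X : Type*} [MeasurableSpace X] {p : ℝ} {m : Measure X} {f : LpR p m} {S B : Set X} (hS : MeasurableSet S) (hSB : S ⊆ B)
    {c a : ℝ} (hf : ∀ᵐ y ∂m, y ∈ S → f y = c) :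
    ‖c - a‖ₑ ^ p * m S ≤ ∫⁻ y in B, ‖f y - a‖ₑ ^ p ∂m := by
  calc ‖c - a‖ₑ ^ p * m S = ∫⁻ _ in S, ‖c - a‖ₑ ^ p ∂m := (setLIntegral_const _ _).symm
    _ = ∫⁻ y in S, ‖f y - a‖ₑ ^ p ∂m := by
        refine setLIntegral_congr_fun_ae hS ?_
        filter_upwards [hf] with y hy hyS
        rw [hy hyS]
    _ ≤ _ := lintegral_mono_set hSB

theorem nonempty_of_lt_diamSpace {X : Type*} [MetricSpace X] {d : ℝ≥0∞} (h : d < diamSpace X) : Nonempty X := by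
  by_contra hX
  rw [not_nonempty_iff] at hX
  have : (univ : Set X) = ∅ := eq_empty_of_isEmpty _
  simp [diamSpace, this] at h

variable {X : Type*} [MetricSpace X] [MeasurableSpace X] {p : ℝ} {m : Measure X}
  {𝓔 : PEnergy p m} {Ψ : ℝ≥0 → ℝ≥0}

/-- Only the existence of a good constant matters below, not that it is the mean. -/
theorem PEnergy.EnergyMeasure.Poincare.exists_const {Γ : 𝓔.EnergyMeasure} (h : Γ.Poincare Ψ) :
    ∃ C A : ℝ≥0, 0 < C ∧ 1 ≤ A ∧ ∀ (x : X) (r : ℝ≥0), 0 < r →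
      ENNReal.ofReal (A * r) < diamSpace X → ∀ f : 𝓔.dom, ∃ a : ℝ,
        ∫⁻ y in Metric.ball x r, ‖(f : LpR p m) y - a‖ₑ ^ p ∂m ≤
          C * Ψ r * Γ.Γ f (Metric.ball x (A * r)) := by
  obtain ⟨C, A, hC, hA, H⟩ := h
  refine ⟨C, A, hC, hA, fun x r hr hd f => ⟨_, H x r hr ?_ f⟩⟩
  have hA0 : (A : ℝ≥0∞) ≠ 0 := by
    have : (0 : ℝ≥0) < A := by positivity
    exact_mod_cast this.ne'
  rw [ENNReal.lt_div_iff_mul_lt (Or.inl hA0) (Or.inl ENNReal.coe_ne_top), mul_comm]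
  have e : ENNReal.ofReal (A * r) = (A : ℝ≥0∞) * r := by
    rw [← NNReal.coe_mul, ENNReal.ofReal_coe_nnreal, ENNReal.coe_mul]
  rwa [← e]

theorem exists_floor_step {t : ℝ} (ht : 1 ≤ t) : ∃ N : ℕ, 0 < N ∧ (N : ℝ) ≤ t ∧ t ≤ 2 * N := by
  refine ⟨⌊t⌋₊, Nat.floor_pos.2 ht, Nat.floor_le (by linarith), ?_⟩
  have h1 : (1 : ℝ) ≤ ⌊t⌋₊ := by exact_mod_cast Nat.floor_pos.2 ht
  linarith [Nat.lt_floor_add_one t]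

theorem div_rpow_mul_le {p c a b r R : ℝ} {N : ℕ} (hp : 0 ≤ p) (hr : 0 < r) (hR : 0 ≤ R)
    (hc : 0 ≤ c) (ha : 0 ≤ a) (hN : R / r ≤ c * N) (h : (N : ℝ) ^ p * a ≤ b) :
    (R / r) ^ p * a ≤ c ^ p * b := by
  calc (R / r) ^ p * a ≤ (c * N) ^ p * a := by gcongr
    _ = c ^ p * ((N : ℝ) ^ p * a) := by
      rw [Real.mul_rpow hc (by positivity)]; ring
    _ ≤ c ^ p * b := by gcongr

variable [BorelSpace X] [LocallyCompactSpace X] [SecondCountableTopology X]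
  [m.IsOpenPosMeasure]

theorem PEnergy.EnergyMeasure.Poincare.lower_bound {Γ : 𝓔.EnergyMeasure} (hPI : Γ.Poincare Ψ)
    (hp : 1 < p) (hCC : ChainCondition X) (hΨ : HasPowerGrowth Ψ) {D : ℝ≥0}
    (hD : LocallyDoubling m D) (hcap : 𝓔.CapUpper Ψ) :
    ∃ C : ℝ, 0 < C ∧ ∀ r R : ℝ≥0, 0 < r → r ≤ R → (R : ℝ≥0∞) < diamSpace X →
      1 / C * ((R : ℝ) / r) ^ p ≤ (Ψ R : ℝ) / Ψ r := by
  have : Fact (1 ≤ ENNReal.ofReal p) := ⟨by simpa using hp.le⟩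
  obtain ⟨C, A, hC, hA, hcap⟩ := hcap
  obtain ⟨C', A', hC', hA', hPI⟩ := hPI.exists_const
  have hA0 : (0 : ℝ) ≤ A := A.2
  have hA'0 : (0 : ℝ) ≤ A' := A'.2
  set ℓ : ℝ := (A : ℝ) + 3 with hℓ
  have hℓ0 : 0 < ℓ := by positivity
  set Q : ℝ≥0 := D ^ 2 + D ^ 4 with hQ
  set K : ℝ≥0 := 2 ^ (p - 1) * 2 * Q * C' * (2 * C * D) with hK
  -- The choice of κ lets at least one step of width ℓ r fit between R/4 and R/2; S keeps every ball
  -- used below the diameter, and the summand 1 only makes the constant positive.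
  refine hΨ.lower_bound_of_small hp (S := 8 + A') (κ := 1 / (4 * ℓ)) (K := (8 * ℓ) ^ p * K + 1)
    (by linarith) (by positivity) (by positivity) fun r R hr hrR hd => ?_
  obtain ⟨x⟩ := nonempty_of_lt_diamSpace hd
  have hr' : (0 : ℝ) < r := by exact_mod_cast hr
  have hR' : (0 : ℝ) < R := by
    by_contra h
    have h0 : (R : ℝ) = 0 := le_antisymm (not_lt.1 h) R.2
    rw [h0, mul_zero] at hrR
    linarith
  have hR : 0 < R := by exact_mod_cast hR'
  have hsmall : ∀ t : ℝ, t ≤ (8 + A') * R → ENNReal.ofReal t < diamSpace X := fun t ht =>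
    ofReal_lt_diamSpace_of_le ht hd
  have hA'R : 0 ≤ A' * (R : ℝ) := by positivity
  have hdiv : 1 ≤ (R : ℝ) / (4 * ℓ * r) := by
    rw [one_le_div (by positivity)]
    rw [one_div, ← div_eq_inv_mul, le_div_iff₀ (by positivity)] at hrR
    linarith
  obtain ⟨N, hN0, hN1, hN2⟩ := exists_floor_step hdiv
  rw [le_div_iff₀ (by positivity)] at hN1
  obtain ⟨f, hf1, hf0, hfE⟩ := PEnergy.exists_ramp Γ hp hD hC hcap x (a := R / 4) (b := R / 2)
    hr (hΨ.pos hr).ne' (by positivity) hN0 (by rw [← hℓ]; nlinarith) (hsmall _ (by linarith))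
  rw [mul_div_cancel₀ _ (two_ne_zero)] at hfE
  obtain ⟨a, ha⟩ := hPI x R hR (hsmall _ (by linarith)) f
  set I := ∫⁻ y in Metric.ball x R, ‖(f : LpR p m) y - a‖ₑ ^ p ∂m with hI
  have hIE : I ≤ C' * Ψ R * 𝓔.energy f := by
    refine ha.trans ?_
    rw [← Γ.total]
    gcongr
    exact subset_univ _
  -- B(w, R/8) lies in B(x, R) and outside B(x, R/2), so f is 0 there and 1 on B(x, R/4). Both balls
  -- have volume comparable to V, and no constant a is close to both values.
  obtain ⟨w, hw1, hw2⟩ := hCC.exists_dist_mem x (s := 5 * R / 8) (δ := R / 8) (by positivity)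
    (by positivity) (hsmall _ (by linarith))
  have hrR8 : (r : ℝ) ≤ R / 8 := by
    have h1 : (1 : ℝ) ≤ N := by exact_mod_cast hN0
    have h2 : (3 : ℝ) ≤ ℓ := by linarith
    have h3 : (r : ℝ) * 3 ≤ r * ℓ := by gcongr
    have h4 : 1 * (4 * ℓ * r) ≤ N * (4 * ℓ * r) := by gcongr
    linarith
  have hI1 : ‖(1 : ℝ) - a‖ₑ ^ p * m (Metric.ball x (R / 4)) ≤ I := by
    refine enorm_const_sub_mul_le measurableSet_ball (Metric.ball_subset_ball (by linarith)) ?_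
    filter_upwards [hf1] with y hy hyB
    rw [Metric.mem_ball] at hyB
    exact hy (by linarith)
  have hI0 : ‖(0 : ℝ) - a‖ₑ ^ p * m (Metric.ball w (R / 8)) ≤ I := by
    refine enorm_const_sub_mul_le measurableSet_ball (fun y hy => ?_) ?_
    · rw [Metric.mem_ball] at hy ⊢
      linarith [dist_triangle y w x]
    · filter_upwards [hf0] with y hy hyB
      rw [Metric.mem_ball] at hyB
      exact hy (by linarith [dist_triangle_left w x y])
  set V := m (Metric.ball x R) with hV
  have hV1 : V ≤ Q * m (Metric.ball x (R / 4)) := by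
    have h := hD.iterate 2 x (r := R / 4) (by positivity) (hsmall _ (by linarith))
    have e : (2 : ℝ) ^ 2 * (R / 4) = R := by ring
    rw [e] at h
    refine h.trans ?_
    gcongr
    rw [hQ]
    push_cast
    exact le_self_add
  have hV0 : V ≤ Q * m (Metric.ball w (R / 8)) := by
    have h := hD.iterate 4 w (r := R / 8) (by positivity) (hsmall _ (by linarith))
    have e : (2 : ℝ) ^ 4 * (R / 8) = 2 * R := by ring
    rw [e] at h
    calc V ≤ m (Metric.ball w (2 * R)) := by
          refine measure_mono fun y hy => ?_
          rw [Metric.mem_ball] at hy ⊢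
          linarith [dist_triangle_right y w x]
      _ ≤ (D : ℝ≥0∞) ^ 4 * m (Metric.ball w (R / 8)) := h
      _ ≤ _ := by
        gcongr
        rw [hQ]
        push_cast
        exact le_add_self
  have hVI : V ≤ 2 ^ (p - 1) * 2 * Q * I := by
    have h1 : (1 : ℝ≥0∞) ≤ 2 ^ (p - 1) * (‖(1 : ℝ) - a‖ₑ ^ p + ‖(0 : ℝ) - a‖ₑ ^ p) := by
      refine le_trans ?_ (ENNReal.rpow_add_le_mul_rpow_add_rpow _ _ hp.le)
      refine ENNReal.one_le_rpow ?_ (by linarith)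
      calc (1 : ℝ≥0∞) = ‖((1 : ℝ) - a) - (0 - a)‖ₑ := by simp
        _ ≤ _ := enorm_sub_le
    calc V = 1 * V := (one_mul _).symm
      _ ≤ 2 ^ (p - 1) * (‖(1 : ℝ) - a‖ₑ ^ p + ‖(0 : ℝ) - a‖ₑ ^ p) * V := by gcongr
      _ = 2 ^ (p - 1) * (‖(1 : ℝ) - a‖ₑ ^ p * V + ‖(0 : ℝ) - a‖ₑ ^ p * V) := by ring
      _ ≤ 2 ^ (p - 1) * (‖(1 : ℝ) - a‖ₑ ^ p * (Q * m (Metric.ball x (R / 4))) +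
            ‖(0 : ℝ) - a‖ₑ ^ p * (Q * m (Metric.ball w (R / 8)))) := by gcongr
      _ = 2 ^ (p - 1) * (Q * (‖(1 : ℝ) - a‖ₑ ^ p * m (Metric.ball x (R / 4))) +
            Q * (‖(0 : ℝ) - a‖ₑ ^ p * m (Metric.ball w (R / 8)))) := by ring
      _ ≤ 2 ^ (p - 1) * (Q * I + Q * I) := by gcongr
      _ = _ := by ring
  have hfinal : (N : ℝ≥0∞) ^ p * V ≤ K * Ψ R * (V / Ψ r) := by
    calc (N : ℝ≥0∞) ^ p * V
        ≤ (N : ℝ≥0∞) ^ p * (2 ^ (p - 1) * 2 * Q * (C' * Ψ R * 𝓔.energy f)) := by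
          gcongr
          exact hVI.trans (by gcongr)
      _ = 2 ^ (p - 1) * 2 * Q * C' * Ψ R * ((N : ℝ≥0∞) ^ p * 𝓔.energy f) := by ring
      _ ≤ 2 ^ (p - 1) * 2 * Q * C' * Ψ R * (2 * C * D * (V / Ψ r)) := by gcongr
      _ = _ := by
        rw [hK]
        push_cast
        rw [ENNReal.coe_rpow_of_nonneg _ (by linarith : 0 ≤ p - 1)]
        push_cast
        ring
  have hreal := natCast_rpow_mul_le (by linarith) (Metric.measure_ball_pos m x hR').ne'
    (hD.2 x _ (hsmall _ (by linarith))) (hΨ.pos hr).ne' hfinal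
  have hRN : (R : ℝ) / r ≤ 8 * ℓ * N := by
    rw [div_le_iff₀ (by positivity)] at hN2 ⊢
    linarith
  calc ((R : ℝ) / r) ^ p * Ψ r ≤ (8 * ℓ) ^ p * (K * Ψ R) :=
        div_rpow_mul_le (by linarith) hr' hR'.le (by positivity) (by positivity) hRN hreal
    _ ≤ _ := by
      rw [← mul_assoc]
      gcongr
      linarith

/-- The ramp from R to A'R competes in the capacity, so its energy is at least a multiple of
V(x,R)/Ψ(R). -/
theorem PEnergy.CapLower.lower_bound (hlow : 𝓔.CapLower Ψ) (Γ : 𝓔.EnergyMeasure)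
    (hp : 1 < p) (hΨ : HasPowerGrowth Ψ) {D : ℝ≥0}
    (hD : LocallyDoubling m D) (hcap : 𝓔.CapUpper Ψ) :
    ∃ C : ℝ, 0 < C ∧ ∀ r R : ℝ≥0, 0 < r → r ≤ R → (R : ℝ≥0∞) < diamSpace X →
      1 / C * ((R : ℝ) / r) ^ p ≤ (Ψ R : ℝ) / Ψ r := by
  have : Fact (1 ≤ ENNReal.ofReal p) := ⟨by simpa using hp.le⟩
  obtain ⟨C, A, hC, hA, hcap⟩ := hcap
  obtain ⟨C', A', hC', hA', hlow⟩ := hlow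
  have hA0 : (0 : ℝ) ≤ A := A.2
  have hA'1 : (0 : ℝ) < A' - 1 := by
    have : (1 : ℝ) < A' := by exact_mod_cast hA'
    linarith
  set ℓ : ℝ := (A : ℝ) + 3 with hℓ
  have hℓ0 : 0 < ℓ := by positivity
  -- One power of 2 serves both the room 8A'R required by the ramp and the doubling from B(x, R) to
  -- B(x, 2A'R).
  obtain ⟨k, hk⟩ := pow_unbounded_of_one_lt (8 * (A' : ℝ)) (one_lt_two : (1 : ℝ) < 2)
  set K : ℝ≥0 := C' * (2 * C * D) * D ^ k with hK
  refine hΨ.lower_bound_of_small hp (S := 2 ^ k) (κ := (A' - 1) / ℓ)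
    (K := (2 * ℓ / (A' - 1)) ^ p * K + 1)
    (one_le_pow₀ one_le_two) (by positivity) (by positivity) fun r R hr hrR hd => ?_
  obtain ⟨x⟩ := nonempty_of_lt_diamSpace hd
  have hr' : (0 : ℝ) < r := by exact_mod_cast hr
  have hR' : (0 : ℝ) < R := by
    by_contra h
    have h0 : (R : ℝ) = 0 := le_antisymm (not_lt.1 h) R.2
    rw [h0, mul_zero] at hrR
    linarith
  have hR : 0 < R := by exact_mod_cast hR'
  have hkR : 8 * (A' : ℝ) * R ≤ 2 ^ k * R := by gcongr
  have hA'R : (R : ℝ) ≤ A' * R := le_mul_of_one_le_left hR'.le (by linarith)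
  have hdiv : 1 ≤ (A' - 1) * (R : ℝ) / (ℓ * r) := by
    rw [one_le_div (by positivity)]
    rw [div_mul_eq_mul_div, le_div_iff₀ (by positivity)] at hrR
    linarith
  obtain ⟨N, hN0, hN1, hN2⟩ := exists_floor_step hdiv
  rw [le_div_iff₀ (by positivity)] at hN1
  obtain ⟨f, hf1, hf0, hfE⟩ := PEnergy.exists_ramp Γ hp hD hC hcap x (a := R) (b := A' * R)
    hr (hΨ.pos hr).ne' hR'.le hN0 (by rw [← hℓ]; linarith)
    (ofReal_lt_diamSpace_of_le (by linarith) hd)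
  set V := m (Metric.ball x R) with hV
  have hVk : m (Metric.ball x (2 * (A' * R))) ≤ (D : ℝ≥0∞) ^ k * V := by
    refine (measure_mono (Metric.ball_subset_ball ?_)).trans (hD.iterate k x hR' hd)
    linarith
  have hcapf : 𝓔.cap (Metric.ball x R) (Metric.ball x (A' * R))ᶜ ≤ 𝓔.energy f := by
    unfold PEnergy.cap
    refine iInf₂_le f ⟨⟨{y | dist y x < R + r}, isOpen_lt (by fun_prop) continuous_const,
      fun y hy => ?_, hf1⟩, {y | A' * R - r < dist y x}, isOpen_lt continuous_const (by fun_prop),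
      fun y hy => ?_, hf0⟩
    · change dist y x < R + r
      rw [Metric.mem_ball] at hy
      linarith
    · change A' * R - r < dist y x
      rw [mem_compl_iff, Metric.mem_ball] at hy
      linarith
  have hVE : V ≤ C' * Ψ R * 𝓔.energy f := by
    have h1 := (hlow x R hR).trans hcapf
    have hC'0 : (C' : ℝ≥0∞) ≠ 0 := by exact_mod_cast hC'.ne'
    have hΨ0 : (Ψ R : ℝ≥0∞) ≠ 0 := by exact_mod_cast (hΨ.pos hR).ne'
    rw [ENNReal.inv_mul_le_iff hC'0 ENNReal.coe_ne_top,
      ENNReal.div_le_iff hΨ0 ENNReal.coe_ne_top] at h1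
    exact h1.trans (le_of_eq (by ring))
  have hfinal : (N : ℝ≥0∞) ^ p * V ≤ K * Ψ R * (V / Ψ r) := by
    calc (N : ℝ≥0∞) ^ p * V
        ≤ (N : ℝ≥0∞) ^ p * (C' * Ψ R * 𝓔.energy f) := by gcongr
      _ = C' * Ψ R * ((N : ℝ≥0∞) ^ p * 𝓔.energy f) := by ring
      _ ≤ C' * Ψ R * (2 * C * D * (m (Metric.ball x (2 * (A' * R))) / Ψ r)) := by gcongr
      _ ≤ C' * Ψ R * (2 * C * D * ((D : ℝ≥0∞) ^ k * V / Ψ r)) := by gcongr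
      _ = _ := by
        rw [hK]
        push_cast
        simp only [div_eq_mul_inv]
        ring
  have hreal := natCast_rpow_mul_le (by linarith) (Metric.measure_ball_pos m x hR').ne'
    (hD.2 x _ (ofReal_lt_diamSpace_of_le (by linarith) hd)) (hΨ.pos hr).ne' hfinal
  have hRN : (R : ℝ) / r ≤ 2 * ℓ / (A' - 1) * N := by
    rw [div_le_iff₀ (by positivity)] at hN2
    rw [div_mul_eq_mul_div, div_le_div_iff₀ hr' hA'1]
    linarith
  calc ((R : ℝ) / r) ^ p * Ψ r ≤ (2 * ℓ / (A' - 1)) ^ p * (K * Ψ R) :=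
        div_rpow_mul_le (by linarith) hr' hR'.le (by positivity) (by positivity) hRN hreal
    _ ≤ _ := by
      rw [← mul_assoc]
      gcongr
      linarith

end LowerBounds

/-! ### The upper bound by chaining the Poincaré inequality. -/

section UpperBound

/-- Integrating |a - b| ≤ |f - a| + |f - b| over a common part S compares the constants of two
overlapping balls. -/
theorem enorm_sub_rpow_mul_le {X : Type*} [MeasurableSpace X] {p : ℝ} {m : Measure X} (hp : 1 ≤ p)
    (f : LpR p m) {S B₁ B₂ : Set X} (h₁ : S ⊆ B₁) (h₂ : S ⊆ B₂) (a b : ℝ) :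
    ‖a - b‖ₑ ^ p * m S ≤ 2 ^ (p - 1) *
      (∫⁻ y in B₁, ‖f y - a‖ₑ ^ p ∂m + ∫⁻ y in B₂, ‖f y - b‖ₑ ^ p ∂m) := by
  have hmeas : Measurable fun y => ‖f y - a‖ₑ ^ p :=
    (((Lp.stronglyMeasurable f).measurable.sub_const a).enorm).pow_const p
  calc ‖a - b‖ₑ ^ p * m S = ∫⁻ _ in S, ‖a - b‖ₑ ^ p ∂m := (setLIntegral_const _ _).symm
    _ ≤ ∫⁻ y in S, 2 ^ (p - 1) * (‖f y - a‖ₑ ^ p + ‖f y - b‖ₑ ^ p) ∂m := by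
        refine lintegral_mono fun y => ?_
        refine le_trans ?_ (ENNReal.rpow_add_le_mul_rpow_add_rpow _ _ hp)
        gcongr
        calc ‖a - b‖ₑ = ‖(f y - b) - (f y - a)‖ₑ := by congr 1; ring
          _ ≤ ‖f y - b‖ₑ + ‖f y - a‖ₑ := enorm_sub_le
          _ = _ := add_comm _ _
    _ = 2 ^ (p - 1) * (∫⁻ y in S, ‖f y - a‖ₑ ^ p ∂m + ∫⁻ y in S, ‖f y - b‖ₑ ^ p ∂m) := by
        rw [lintegral_const_mul' _ _ (by finiteness), lintegral_add_left hmeas]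
    _ ≤ _ := by
        gcongr

/-- Telescoping followed by Hölder; the factor l^(p-1) is the source of (R/r)^(p-1). -/
theorem enorm_sub_rpow_le_sum {p : ℝ} (hp : 1 ≤ p) (a : ℕ → ℝ) (l : ℕ) :
    ‖a l - a 0‖ₑ ^ p ≤
      (l : ℝ≥0∞) ^ (p - 1) * ∑ i ∈ Finset.range l, ‖a (i + 1) - a i‖ₑ ^ p := by
  calc ‖a l - a 0‖ₑ ^ p ≤ (∑ i ∈ Finset.range l, ‖a (i + 1) - a i‖ₑ) ^ p := by
        rw [← Finset.sum_range_sub]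
        gcongr
        exact enorm_sum_le _ _
    _ ≤ _ := by
        simpa using ENNReal.rpow_sum_le_const_mul_sum_rpow (Finset.range l)
          (fun i => ‖a (i + 1) - a i‖ₑ) hp

theorem sum_range_succ_add_le (G : ℕ → ℝ≥0∞) (l : ℕ) :
    ∑ i ∈ Finset.range l, (G (i + 1) + G i) ≤ 2 * ∑ i ∈ Finset.range (l + 1), G i := by
  rw [Finset.sum_add_distrib, two_mul]
  gcongr
  · rw [Finset.sum_range_succ' G]; exact le_self_add
  · omega

variable {X : Type*} [MetricSpace X] [MeasurableSpace X] {p : ℝ} {m : Measure X}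
  {𝓔 : PEnergy p m} {Φ Ψ : ℝ≥0 → ℝ≥0}

variable [BorelSpace X] [m.IsOpenPosMeasure]

theorem PEnergy.EnergyMeasure.Poincare.upper_bound_of_small {Γ : 𝓔.EnergyMeasure}
    (hPI : Γ.Poincare Ψ) (hp : 1 < p) (hCC : ChainCondition X) (hΨ : HasPowerGrowth Ψ) {D : ℝ≥0}
    (hD : LocallyDoubling m D) (hΦ : VolumeRegular m Φ) (hcap : 𝓔.CapUpper Ψ) :
    ∃ S κ K : ℝ, 1 ≤ S ∧ 0 < κ ∧ 0 < K ∧ ∀ r R : ℝ≥0, 0 < r → (r : ℝ) ≤ κ * R →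
      ENNReal.ofReal (S * R) < diamSpace X →
      (Ψ R : ℝ) * Φ r ≤ K * ((R : ℝ) / r) ^ (p - 1) * (Ψ r * Φ R) := by
  classical
  obtain ⟨C, A, hC, hA, hcap⟩ := hcap
  obtain ⟨C', A', hC', hA', hPI⟩ := hPI.exists_const
  obtain ⟨Kv, hKv, hΦ⟩ := hΦ
  obtain ⟨K₃, hK₃, hΨ₃⟩ := hΨ.exists_le_of_le_mul (lam := 3) (by norm_num)
  have hCC' := hCC
  obtain ⟨Cc, hCc, hCC⟩ := hCC
  have hA1 : (1 : ℝ) < A := by exact_mod_cast hA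
  have hA'1 : (1 : ℝ) ≤ A' := by exact_mod_cast hA'
  -- Balls of radius 3A'r through a common point have centres within ρ = 6A'r of each other, and 4ρ
  -- = 24A'r is what the packing bound must reach.
  obtain ⟨k, hk1, hk2⟩ := exists_two_pow_mul_mem (s := 1 / 2) (t := 24 * (A' : ℝ)) (by norm_num)
    (by linarith)
  set c : ℝ := 2 * Cc * (A + 1) + 1 with hc
  have hc0 : 0 < c := by positivity
  set K₁ : ℝ≥0 := Kv * 2 ^ (p - 1) * C' * 2 * D ^ k * (2 * C * Kv) with hK₁
  -- With 4r ≤ R, the ball B(x, 3r) lies in B(x, R), and a ball of radius 3r centred within r of y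
  -- misses B(x, AR).
  refine ⟨2 * (A + 1) + 12 * A', 1 / 4, c ^ (p - 1) * K₁ * K₃ + 1, by linarith, by norm_num,
    by positivity, fun r R hr hrR hd => ?_⟩
  obtain ⟨x⟩ := nonempty_of_lt_diamSpace hd
  have hr' : (0 : ℝ) < r := by exact_mod_cast hr
  have hR' : (0 : ℝ) < R := by linarith
  have hR : 0 < R := by exact_mod_cast hR'
  have hsmall : ∀ t : ℝ, t ≤ (2 * (A + 1) + 12 * A') * R → ENNReal.ofReal t < diamSpace X :=
    fun t ht => ofReal_lt_diamSpace_of_le ht hd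
  have hAR : (R : ℝ) ≤ A * R := le_mul_of_one_le_left hR'.le hA1.le
  have hA'R : (R : ℝ) ≤ A' * R := le_mul_of_one_le_left hR'.le hA'1
  have hA'r : (r : ℝ) ≤ A' * r := le_mul_of_one_le_left hr'.le hA'1
  have hA'rR : A' * (r : ℝ) ≤ A' * R / 4 := by
    have : A' * (r : ℝ) ≤ A' * (1 / 4 * R) := by gcongr
    linarith
  obtain ⟨y, hy1, hy2⟩ := hCC'.exists_dist_mem x (s := (A + 1) * R) (δ := (A + 1) * R)
    (by positivity) (by positivity) (hsmall _ (by linarith))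
  have hRd : (R : ℝ≥0∞) < diamSpace X := by
    rw [← ENNReal.ofReal_coe_nnreal]; exact hsmall _ (by linarith)
  have hrd : (r : ℝ≥0∞) < diamSpace X := by
    rw [← ENNReal.ofReal_coe_nnreal]; exact hsmall _ (by linarith)
  -- a separated chain of balls of radius `r` from `x` to `y`
  set n : ℕ := ⌈Cc * (2 * (A + 1) * R) / r⌉₊ with hn
  have hn0 : 0 < n := Nat.ceil_pos.2 (by positivity)
  have hn1 : Cc * (2 * (A + 1) * R) / r ≤ n := Nat.le_ceil _
  have hn2 : (n : ℝ) ≤ c * (R / r) := by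
    have h1 := (Nat.ceil_lt_add_one (show 0 ≤ Cc * (2 * (A + 1) * R) / r by positivity)).le
    have h2 : 1 ≤ (R : ℝ) / r := by rw [one_le_div hr']; linarith
    calc (n : ℝ) ≤ Cc * (2 * (A + 1) * R) / r + R / r := by linarith
      _ = c * (R / r) := by rw [hc]; ring
  obtain ⟨s, hs0, hsn, hs⟩ := hCC x y n hn0
  have hn' : (0 : ℝ) < n := by exact_mod_cast hn0
  obtain ⟨l, hln, t, ht0, htl, ht1, ht2, -⟩ := exists_separated_chain hr' n s fun i hi => by
    refine (hs i hi).trans ?_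
    rw [← mul_div_assoc, div_le_iff₀ hn']
    rw [div_le_iff₀ hr'] at hn1
    rw [dist_comm x y]
    calc Cc * dist y x ≤ Cc * (2 * (A + 1) * R) := by gcongr; linarith
      _ ≤ _ := by linarith
  rw [hs0] at ht0
  rw [hsn] at htl
  have hl0 : l ≠ 0 := by
    rintro rfl
    rw [ht0, dist_comm] at htl
    linarith
  obtain ⟨f, -, hf1, hf0, hfE⟩ := PEnergy.exists_cutoff (𝓔 := 𝓔) hC hR (hcap x R hR)
    (hΨ.pos hR).ne' (hD.2 x _ (hsmall _ (by linarith)))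
  have h3r : ((3 * r : ℝ≥0) : ℝ) = 3 * r := by push_cast; rfl
  -- Radius 3r makes the ball around each chain point contain the r-ball around its neighbour, which
  -- is at most 2r away. At the two ends f is constant on the ball, so the constants can be taken
  -- exactly 1 and 0.
  have hconst : ∀ i, ∃ a : ℝ, ∫⁻ z in Metric.ball (t i) (3 * r : ℝ≥0),
      ‖(f : LpR p m) z - a‖ₑ ^ p ∂m ≤
        C' * Ψ (3 * r) * Γ.Γ f (Metric.ball (t i) (A' * (3 * r : ℝ≥0))) ∧
      (i = 0 → a = 1) ∧ (i = l → a = 0) := by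
    have hzero : ∀ i, ∀ a : ℝ, (∀ᵐ z ∂m, z ∈ Metric.ball (t i) (3 * r : ℝ≥0) →
        (f : LpR p m) z = a) → ∫⁻ z in Metric.ball (t i) (3 * r : ℝ≥0),
        ‖(f : LpR p m) z - a‖ₑ ^ p ∂m = 0 := by
      intro i a ha
      rw [setLIntegral_congr_fun_ae (g := fun _ => 0) measurableSet_ball, lintegral_zero]
      filter_upwards [ha] with z hz hzB
      rw [hz hzB, sub_self, enorm_zero, ENNReal.zero_rpow_of_pos (by linarith)]
    intro i
    by_cases hi0 : i = 0
    · refine ⟨1, ?_, fun _ => rfl, fun h => absurd (h.symm.trans hi0) hl0⟩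
      rw [hzero i 1]
      · exact zero_le
      filter_upwards [hf1] with z hz hzB
      rw [Metric.mem_ball, h3r, hi0, ht0] at hzB
      exact hz (by linarith)
    by_cases hil : i = l
    · refine ⟨0, ?_, fun h => absurd h hi0, fun _ => rfl⟩
      rw [hzero i 0]
      · exact zero_le
      filter_upwards [hf0] with z hz hzB
      rw [Metric.mem_ball, h3r, hil] at hzB
      refine hz ?_
      have h1 := dist_triangle y (t l) x
      have h2 := dist_triangle_left (t l) x z
      rw [dist_comm y (t l)] at h1
      linarith
    · obtain ⟨a, ha⟩ := hPI (t i) (3 * r) (by positivity)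
        (hsmall _ (by rw [h3r]; linarith)) f
      exact ⟨a, ha, fun h => absurd h hi0, fun h => absurd h hil⟩
  choose a ha ha0 hal using hconst
  set G : ℕ → ℝ≥0∞ := fun i => Γ.Γ f (Metric.ball (t i) (A' * (3 * r : ℝ≥0))) with hG
  have hoverlap : ∑ i ∈ Finset.range (l + 1), G i ≤ (D : ℝ≥0∞) ^ k * 𝓔.energy f := by
    rw [← Γ.total]
    refine sum_measure_le_of_card_le _ _ (fun i => measurableSet_ball) fun z => ?_
    rcases (Finset.filter (fun i => z ∈ Metric.ball (t i) (A' * (3 * r : ℝ≥0)))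
      (Finset.range (l + 1))).eq_empty_or_nonempty with h | ⟨i₀, hi₀⟩
    · rw [h]; simp
    · have hzi : ∀ i ∈ Finset.filter (fun i => z ∈ Metric.ball (t i) (A' * (3 * r : ℝ≥0)))
          (Finset.range (l + 1)), i ≤ l ∧ dist z (t i) < 3 * (A' * r) := by
        intro i hi
        rw [Finset.mem_filter, Finset.mem_range, Metric.mem_ball, h3r] at hi
        exact ⟨by omega, by linarith [hi.2]⟩
      refine hD.card_le (t := t) (x := t i₀) (ρ := 6 * (A' * r)) hr' (by linarith) ?_ ?_
        (k := k) ?_ (hsmall _ ?_)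
      · intro i hi
        linarith [dist_triangle_left (t i) (t i₀) z, (hzi i hi).2, (hzi i₀ hi₀).2]
      · exact fun i hi j hj hij => ht2 i (hzi i hi).1 j (hzi j hj).1 hij
      · have h2 : 24 * (A' : ℝ) * r ≤ 2 ^ k * (1 / 2) * r := by gcongr
        linarith
      · have h2 : 2 ^ k * (1 / 2) * (r : ℝ) ≤ 2 * (24 * A') * r := by gcongr
        linarith
  have hstep : ∀ i ∈ Finset.range l, ‖a (i + 1) - a i‖ₑ ^ p * Φ r ≤
      Kv * 2 ^ (p - 1) * C' * Ψ (3 * r) * (G (i + 1) + G i) := by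
    intro i hi
    have hKv0 : (Kv : ℝ≥0∞) ≠ 0 := by exact_mod_cast hKv.ne'
    have h1 := (hΦ (t i) r hr hrd).1
    rw [ENNReal.div_le_iff hKv0 ENNReal.coe_ne_top] at h1
    have h2 := enorm_sub_rpow_mul_le hp.le (f : LpR p m) (S := Metric.ball (t i) r)
      (B₁ := Metric.ball (t (i + 1)) (3 * r : ℝ≥0)) (B₂ := Metric.ball (t i) (3 * r : ℝ≥0))
      (fun z hz => by
        rw [Metric.mem_ball] at hz ⊢
        rw [h3r]
        have := ht1 i (Finset.mem_range.1 hi)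
        linarith [dist_triangle_right z (t (i + 1)) (t i)])
      (Metric.ball_subset_ball (by rw [h3r]; linarith)) (a (i + 1)) (a i)
    calc ‖a (i + 1) - a i‖ₑ ^ p * Φ r
        ≤ ‖a (i + 1) - a i‖ₑ ^ p * (m (Metric.ball (t i) r) * Kv) := by gcongr
      _ = Kv * (‖a (i + 1) - a i‖ₑ ^ p * m (Metric.ball (t i) r)) := by ring
      _ ≤ Kv * (2 ^ (p - 1) * (C' * Ψ (3 * r) * G (i + 1) + C' * Ψ (3 * r) * G i)) := by
        refine mul_le_mul_right (h2.trans ?_) _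
        gcongr
        · exact ha (i + 1)
        · exact ha i
      _ = _ := by ring
  have hmain : (Φ r : ℝ≥0∞) ≤ (l : ℝ≥0∞) ^ (p - 1) *
      (Kv * 2 ^ (p - 1) * C' * Ψ (3 * r) * (2 * ((D : ℝ≥0∞) ^ k * 𝓔.energy f))) := by
    have h1 := enorm_sub_rpow_le_sum hp.le a l
    rw [ha0 0 rfl, hal l rfl, zero_sub, enorm_neg, enorm_one, ENNReal.one_rpow] at h1
    calc (Φ r : ℝ≥0∞) = 1 * Φ r := (one_mul _).symm
      _ ≤ ((l : ℝ≥0∞) ^ (p - 1) * ∑ i ∈ Finset.range l, ‖a (i + 1) - a i‖ₑ ^ p) * Φ r := by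
        gcongr
      _ = (l : ℝ≥0∞) ^ (p - 1) * ∑ i ∈ Finset.range l, ‖a (i + 1) - a i‖ₑ ^ p * Φ r := by
        rw [mul_assoc, Finset.sum_mul]
      _ ≤ (l : ℝ≥0∞) ^ (p - 1) * ∑ i ∈ Finset.range l,
            Kv * 2 ^ (p - 1) * C' * Ψ (3 * r) * (G (i + 1) + G i) := by
        exact mul_le_mul_right (Finset.sum_le_sum hstep) _
      _ = (l : ℝ≥0∞) ^ (p - 1) * (Kv * 2 ^ (p - 1) * C' * Ψ (3 * r) *
            ∑ i ∈ Finset.range l, (G (i + 1) + G i)) := by rw [← Finset.mul_sum]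
      _ ≤ _ := by
        gcongr
        exact (sum_range_succ_add_le G l).trans (by gcongr)
  have hE : (𝓔.energy f : ℝ≥0∞) * Ψ R ≤ 2 * C * (Kv * Φ R) := by
    have hΨ0 : (Ψ R : ℝ≥0∞) ≠ 0 := by exact_mod_cast (hΨ.pos hR).ne'
    rw [← ENNReal.le_div_iff_mul_le (Or.inl hΨ0) (Or.inl ENNReal.coe_ne_top), mul_div_assoc]
    refine hfE.trans ?_
    gcongr
    exact (hΦ x R hR hRd).2
  have hp1 : 0 ≤ p - 1 := by linarith
  have hfinal : (Φ r * Ψ R : ℝ≥0∞) ≤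
      (((l : ℝ≥0) ^ (p - 1) * K₁ * Ψ (3 * r) * Φ R : ℝ≥0) : ℝ≥0∞) := by
    calc (Φ r * Ψ R : ℝ≥0∞) ≤ (l : ℝ≥0∞) ^ (p - 1) *
          (Kv * 2 ^ (p - 1) * C' * Ψ (3 * r) * (2 * ((D : ℝ≥0∞) ^ k * 𝓔.energy f))) * Ψ R := by
          gcongr
      _ = (l : ℝ≥0∞) ^ (p - 1) * (Kv * 2 ^ (p - 1) * C' * Ψ (3 * r) *
            (2 * (D : ℝ≥0∞) ^ k * (𝓔.energy f * Ψ R))) := by ring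
      _ ≤ (l : ℝ≥0∞) ^ (p - 1) * (Kv * 2 ^ (p - 1) * C' * Ψ (3 * r) *
            (2 * (D : ℝ≥0∞) ^ k * (2 * C * (Kv * Φ R)))) := by gcongr
      _ = _ := by
        rw [hK₁]
        push_cast
        rw [ENNReal.coe_rpow_of_nonneg _ hp1, ENNReal.coe_rpow_of_nonneg _ hp1]
        push_cast
        ring
  have hreal : (Φ r : ℝ) * Ψ R ≤ (l : ℝ) ^ (p - 1) * K₁ * Ψ (3 * r) * Φ R := by
    exact_mod_cast hfinal
  have hl : (l : ℝ) ≤ c * (R / r) := le_trans (by exact_mod_cast hln) hn2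
  have hΨ3 : (Ψ (3 * r) : ℝ) ≤ K₃ * Ψ r :=
    hΨ₃ r (3 * r) hr (le_mul_of_one_le_left zero_le (by norm_num)) (by rw [h3r])
  calc (Ψ R : ℝ) * Φ r = Φ r * Ψ R := mul_comm _ _
    _ ≤ (l : ℝ) ^ (p - 1) * K₁ * Ψ (3 * r) * Φ R := hreal
    _ ≤ (c * (R / r)) ^ (p - 1) * K₁ * (K₃ * Ψ r) * Φ R := by gcongr
    _ = c ^ (p - 1) * K₁ * K₃ * (R / r) ^ (p - 1) * (Ψ r * Φ R) := by
      rw [Real.mul_rpow hc0.le (by positivity)]; ring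
    _ ≤ _ := by
      gcongr
      linarith

/-- Shrink R by the factor S; when r is then not small against it, R / r is bounded and the growth
of Ψ with almost monotonicity of Φ suffices. -/
theorem PEnergy.EnergyMeasure.Poincare.upper_bound {Γ : 𝓔.EnergyMeasure}
    (hPI : Γ.Poincare Ψ) (hp : 1 < p) (hCC : ChainCondition X) (hΨ : HasPowerGrowth Ψ) {D : ℝ≥0}
    (hD : LocallyDoubling m D) (hΦ : VolumeRegular m Φ) (hcap : 𝓔.CapUpper Ψ) :
    ∃ C : ℝ, 0 < C ∧ ∀ r R : ℝ≥0, 0 < r → r ≤ R → (R : ℝ≥0∞) < diamSpace X →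
      (Ψ R : ℝ) / Ψ r ≤ C * ((R : ℝ) / r) ^ (p - 1) * ((Φ R : ℝ) / Φ r) := by
  rcases isEmpty_or_nonempty X with hX | hX
  · refine ⟨1, one_pos, fun r R _ _ hd => ?_⟩
    obtain ⟨x⟩ := nonempty_of_lt_diamSpace hd
    exact hX.elim x
  obtain ⟨S, κ, K, hS, hκ, hK, H⟩ := hPI.upper_bound_of_small hp hCC hΨ hD hΦ hcap
  have hS0 : 0 < S := by linarith
  obtain ⟨K₁, hK₁, hΨ₁⟩ := hΨ.exists_le_of_le_mul (lam := S / κ) (by positivity)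
  obtain ⟨K₂, hK₂, hΨ₂⟩ := hΨ.exists_le_of_le_mul (lam := S) hS0
  obtain ⟨K₃, hK₃, hΦ₃⟩ := hΦ.exists_le
  refine ⟨K₂ * K * K₃ + K₁ * K₃, by positivity, fun r R hr hrR hR => ?_⟩
  have hr' : (0 : ℝ) < r := by exact_mod_cast hr
  have hR' : (0 : ℝ) < R := by exact_mod_cast hr.trans_le hrR
  have hrd : (r : ℝ≥0∞) < diamSpace X := lt_of_le_of_lt (by exact_mod_cast hrR) hR
  have hΨr : (0 : ℝ) < Ψ r := by exact_mod_cast hΨ.pos hr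
  have hΦr : (0 : ℝ) < Φ r := by exact_mod_cast hΦ.pos hr hrd
  have hp1 : 0 ≤ p - 1 := by linarith
  rw [mul_div_assoc', div_le_div_iff₀ hΨr hΦr]
  set R' : ℝ≥0 := R / S.toNNReal with hR'def
  have hRS : (R' : ℝ) = R / S := by rw [hR'def]; simp [hS0.le]
  have hR'R : R' ≤ R := by
    rw [← NNReal.coe_le_coe, hRS]
    exact div_le_self hR'.le hS
  have hR'0 : 0 < R' := by
    rw [← NNReal.coe_pos, hRS]; positivity
  by_cases hrk : (r : ℝ) ≤ κ * R'
  · have h1 := H r R' hr hrk (by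
      rw [hRS, mul_div_cancel₀ _ hS0.ne', ENNReal.ofReal_coe_nnreal]; exact hR)
    have h2 := hΨ₂ R' R hR'0 hR'R (by rw [hRS, mul_div_cancel₀ _ hS0.ne'])
    have h3 := hΦ₃ R' R hR'0 hR'R hR
    have h4 : (R' : ℝ) ≤ R := by exact_mod_cast hR'R
    calc (Ψ R : ℝ) * Φ r ≤ K₂ * Ψ R' * Φ r := by gcongr
      _ = K₂ * (Ψ R' * Φ r) := by ring
      _ ≤ K₂ * (K * ((R' : ℝ) / r) ^ (p - 1) * (Ψ r * Φ R')) := by gcongr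
      _ ≤ K₂ * (K * ((R : ℝ) / r) ^ (p - 1) * (Ψ r * (K₃ * Φ R))) := by gcongr
      _ = K₂ * K * K₃ * ((R : ℝ) / r) ^ (p - 1) * Φ R * Ψ r := by ring
      _ ≤ _ := by
        gcongr
        linarith [mul_pos hK₁ hK₃]
  · have h1 : (R : ℝ) ≤ S / κ * r := by
      rw [not_le, hRS, ← mul_div_assoc, div_lt_iff₀ hS0] at hrk
      rw [div_mul_eq_mul_div, le_div_iff₀ hκ]
      linarith
    have h2 := hΨ₁ r R hr hrR h1
    have h3 := hΦ₃ r R hr hrR hR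
    have h4 : 1 ≤ ((R : ℝ) / r) ^ (p - 1) :=
      Real.one_le_rpow ((one_le_div hr').2 (by exact_mod_cast hrR)) hp1
    calc (Ψ R : ℝ) * Φ r ≤ K₁ * Ψ r * (K₃ * Φ R) := by gcongr
      _ = K₁ * K₃ * 1 * Φ R * Ψ r := by ring
      _ ≤ (K₂ * K * K₃ + K₁ * K₃) * ((R : ℝ) / r) ^ (p - 1) * Φ R * Ψ r := by
        gcongr
        have : 0 ≤ K₂ * K * K₃ := by positivity
        linarith

end UpperBound

/-! ### Power functions and comparison of exponents. -/

section Powers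

theorem isDoubling_rpow {a : ℝ} (ha : 0 < a) : IsDoubling fun r : ℝ≥0 => r ^ a := by
  refine ⟨(NNReal.orderIsoRpow a ha).toHomeomorph.isHomeomorph, 2 ^ a + 1, ?_, fun r _ => ?_⟩
  · have : 0 < (2 : ℝ≥0) ^ a := NNReal.rpow_pos two_pos
    exact lt_add_of_pos_left _ this
  · beta_reduce
    rw [NNReal.mul_rpow]
    gcongr
    exact le_self_add

theorem hasPowerGrowth_rpow {a : ℝ} (ha : 0 < a) : HasPowerGrowth fun r : ℝ≥0 => r ^ a := by
  refine ⟨1, a, a, one_pos, ha, le_rfl, fun r R _ _ => ?_⟩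
  push_cast
  rw [Real.div_rpow (by positivity) (by positivity)]
  simp

theorem le_of_forall_rpow_le {a b C : ℝ} (h : ∀ t : ℝ, 1 ≤ t → t ^ a ≤ C * t ^ b) : a ≤ b := by
  by_contra! hab
  obtain ⟨t, ht1, ht2⟩ := ((tendsto_rpow_atTop (sub_pos.2 hab)).eventually_gt_atTop C).and
    (eventually_ge_atTop 1) |>.exists
  have ht : 0 < t := by linarith
  have h1 := h t ht2
  rw [Real.rpow_sub ht, lt_div_iff₀ (by positivity)] at ht1
  linarith

end Powers

/-! ### Assembly of the four assertions. -/

theorem proposition2p1 {X : Type*} [MetricSpace X] [LocallyCompactSpace X]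
    [TopologicalSpace.SeparableSpace X] [MeasurableSpace X] [BorelSpace X]
    (m : Measure X) [m.Regular] [m.IsOpenPosMeasure]
    (p : ℝ) (hp : 1 < p) (𝓔 : PEnergy p m) (Γ : 𝓔.EnergyMeasure) (hCC : ChainCondition X) :
    -- the two-sided bound
    (∀ Φ Ψ : ℝ≥0 → ℝ≥0, IsDoubling Φ → IsDoubling Ψ → HasPowerGrowth Ψ →
      VolumeRegular m Φ → Γ.Poincare Ψ → 𝓔.CapUpper Ψ →
      ∃ C : ℝ, 0 < C ∧ ∀ r R : ℝ≥0, 0 < r → r ≤ R → (R : ℝ≥0∞) < diamSpace X →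
        1 / C * ((R : ℝ) / r) ^ p ≤ (Ψ R : ℝ) / Ψ r ∧
        (Ψ R : ℝ) / Ψ r ≤ C * ((R : ℝ) / r) ^ (p - 1) * ((Φ R : ℝ) / Φ r)) ∧
    -- the Ahlfors regular case
    (Nontrivial X → ∀ d_h β_p : ℝ, 0 < d_h → 0 < β_p →
      VolumeRegular m (fun r => r ^ d_h) → Γ.Poincare (fun r => r ^ β_p) →
      𝓔.CapUpper (fun r => r ^ β_p) →
      p ≤ β_p ∧ β_p ≤ d_h + (p - 1)) ∧
    -- the lower bound under volume doubling and the Poincaré inequality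
    (∀ Ψ : ℝ≥0 → ℝ≥0, IsDoubling Ψ → HasPowerGrowth Ψ →
      VolumeDoubling m → Γ.Poincare Ψ → 𝓔.CapUpper Ψ →
      ∃ C : ℝ, 0 < C ∧ ∀ r R : ℝ≥0, 0 < r → r ≤ R → (R : ℝ≥0∞) < diamSpace X →
        1 / C * ((R : ℝ) / r) ^ p ≤ (Ψ R : ℝ) / Ψ r) ∧
    -- the lower bound under volume doubling and two-sided capacity bounds
    (∀ Ψ : ℝ≥0 → ℝ≥0, IsDoubling Ψ → HasPowerGrowth Ψ →
      VolumeDoubling m → 𝓔.CapUpper Ψ → 𝓔.CapLower Ψ →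
      ∃ C : ℝ, 0 < C ∧ ∀ r R : ℝ≥0, 0 < r → r ≤ R → (R : ℝ≥0∞) < diamSpace X →
        1 / C * ((R : ℝ) / r) ^ p ≤ (Ψ R : ℝ) / Ψ r) := by
  have : SecondCountableTopology X := UniformSpace.secondCountable_of_separable X
  have two_sided : ∀ Φ Ψ : ℝ≥0 → ℝ≥0, IsDoubling Φ → HasPowerGrowth Ψ →
      VolumeRegular m Φ → Γ.Poincare Ψ → 𝓔.CapUpper Ψ →
      ∃ C : ℝ, 0 < C ∧ ∀ r R : ℝ≥0, 0 < r → r ≤ R → (R : ℝ≥0∞) < diamSpace X →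
        1 / C * ((R : ℝ) / r) ^ p ≤ (Ψ R : ℝ) / Ψ r ∧
        (Ψ R : ℝ) / Ψ r ≤ C * ((R : ℝ) / r) ^ (p - 1) * ((Φ R : ℝ) / Φ r) := by
    intro Φ Ψ hΦ hΨ hV hPI hcap
    obtain ⟨D, hD⟩ := hV.locallyDoubling hΦ
    obtain ⟨C₁, hC₁, H₁⟩ := hPI.lower_bound hp hCC hΨ hD hcap
    obtain ⟨C₂, hC₂, H₂⟩ := hPI.upper_bound hp hCC hΨ hD hV hcap
    refine ⟨C₁ + C₂, by positivity, fun r R hr hrR hd => ⟨?_, ?_⟩⟩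
    · refine le_trans ?_ (H₁ r R hr hrR hd)
      gcongr
      linarith
    · refine (H₂ r R hr hrR hd).trans ?_
      gcongr
      linarith
  refine ⟨fun Φ Ψ hΦ _ hΨ => two_sided Φ Ψ hΦ hΨ, ?_, ?_, ?_⟩
  · intro hX d_h β_p hdh hβ hV hPI hcap
    obtain ⟨C, hC, H⟩ := two_sided _ _ (isDoubling_rpow hdh) (hasPowerGrowth_rpow hβ) hV hPI hcap
    have hdiam : 0 < diamSpace X := Metric.ediam_pos_iff'.2 (by
      obtain ⟨a, b, hab⟩ := exists_pair_ne X
      exact ⟨a, mem_univ a, b, mem_univ b, hab⟩)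
    -- The diameter may be finite, so R is fixed and r = R / t with t → ∞; the bounds then become
    -- inequalities between powers of t.
    obtain ⟨R, hR0, hR⟩ := ENNReal.lt_iff_exists_nnreal_btwn.1 hdiam
    have hR0' : 0 < R := by exact_mod_cast hR0
    have hR' : (0 : ℝ) < R := by exact_mod_cast hR0'
    have key : ∀ t : ℝ, 1 ≤ t → t ^ p ≤ C * t ^ β_p ∧ t ^ β_p ≤ C * t ^ (d_h + (p - 1)) := by
      intro t ht
      have ht0 : 0 < t := by linarith
      have hr : ((R / t.toNNReal : ℝ≥0) : ℝ) = R / t := by simp [ht0.le]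
      have h := H (R / t.toNNReal) R (by rw [← NNReal.coe_pos, hr]; positivity)
        (by rw [← NNReal.coe_le_coe, hr]; exact div_le_self hR'.le ht) hR
      have hdiv : ∀ b : ℝ, ((R ^ b : ℝ≥0) : ℝ) / (((R / t.toNNReal : ℝ≥0) ^ b : ℝ≥0) : ℝ) =
          t ^ b := fun b => by
        rw [NNReal.coe_rpow, NNReal.coe_rpow, hr, ← Real.div_rpow hR'.le (by positivity),
          div_div_cancel₀ hR'.ne']
      beta_reduce at h
      rw [hdiv, hdiv, hr, div_div_cancel₀ hR'.ne', one_div, inv_mul_le_iff₀ hC, mul_assoc,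
        ← Real.rpow_add ht0, add_comm (p - 1)] at h
      exact h
    exact ⟨le_of_forall_rpow_le fun t ht => (key t ht).1,
      le_of_forall_rpow_le fun t ht => (key t ht).2⟩
  · intro Ψ _ hΨ hV hPI hcap
    obtain ⟨D, hD⟩ := hV.locallyDoubling
    exact hPI.lower_bound hp hCC hΨ hD hcap
  · intro Ψ _ hΨ hV hcap hlow
    obtain ⟨D, hD⟩ := hV.locallyDoubling
    exact hlow.lower_bound Γ hp hΨ hD hcap
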